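/- For real $\lambda>0$, $\nu>0$ and $-1<x<1$ let $${}^{r}G_\nu^{(\lambda)}(x)={}_2F_1\Big(-\nu,\nu+2\lambda;\lambda+\tfrac12;\tfrac{1-x}{2}\Big)=\sum_{j\ge 0}\frac{(-\nu)_j(\nu+2\lambda)_j}{j!\,(\lambda+1/2)_j}\Big(\frac{1-x}{2}\Big)^j$$ be the right generalised Gegenbauer function of fractional degree $\nu$, where $(a)_j=a(a+1)\cdots(a+j-1)$. Consider the bound $$\Big|(\sin\varphi)^{\lambda}\,{}^{r}G_\nu^{(\lambda)}(\cos\varphi)-\frac{2^\lambda\,\Gamma(\lambda+1/2)}{\sqrt{\pi}\,(\nu+\lambda)^{\lambda}}\cos\big((\nu+\lambda)\varphi-\lambda\pi/2\big)\Big|\le\frac{B_\nu^{(\lambda)}}{\nu^{\lambda+1}\sin\varphi}.\qquad(*)$$ (i) If $0<\lambda\le 2$ and $\nu+\lambda>1$, then $(*)$ holds for all $\varphi\in(0,\pi)$ with $$B_\nu^{(\lambda)}=\frac{\lambda\,|\lambda-1|\,2^\lambda\,\Gamma(\lambda+1/2)}{\sqrt{\pi}}\cdot\frac{3\nu+5\lambda-1}{3(\nu+\lambda-1)}\,\exp\Big(\frac{1-\lambda^2}{\nu+\lambda-1}\Big).$$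 (ii) If $\lambda>2$ and $\nu>\lambda-3$, then for every constant $c>0$ the bound $(*)$ holds for all $\varphi\in[c\nu^{-1},\pi-c\nu^{-1}]$ with $$B_\nu^{(\lambda)}=\frac{\lambda(\lambda-1)2^{3\lambda/2}\,\Gamma(\lambda+1/2)}{3\sqrt{\pi}}\bigg\{\frac{3\nu+2\lambda+5}{\nu+1}+\Big(\frac{\pi}{4c}\Big)^{\lambda-2}\frac{\Gamma(2\lambda-1)}{\Gamma(\lambda+1)}\cdot\frac{3\nu+\lambda+7}{\nu-\lambda+3}\,\exp\Big(\frac{(2\lambda-5)(\lambda+1)}{\nu-\lambda+3}\Big)\bigg\}.$$ -/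

import Mathlib

noncomputable section

/-- The right generalised Gegenbauer function of fractional degree `nu`:
`₂F₁(-nu, nu + 2 lam; lam + 1/2; (1 - x) / 2)`, as a power series, for `-1 < x < 1`. -/
def rightGegenbauer (lam nu x : ℝ) : ℝ :=
  ordinaryHypergeometric (-nu) (nu + 2 * lam) (lam + 1 / 2) ((1 - x) / 2)

/-- The leading cosine term
`2^lam Γ(lam + 1/2) / (√π (nu + lam)^lam) * cos ((nu + lam) φ - lam π / 2)`. -/
def gegenbauerLeadingTerm (lam nu φ : ℝ) : ℝ :=
  (2 : ℝ) ^ lam * Real.Gamma (lam + 1 / 2) / (Real.sqrt Real.pi * (nu + lam) ^ lam) *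
    Real.cos ((nu + lam) * φ - lam * Real.pi / 2)

/-- The constant of the error bound for `0 < lam ≤ 2`. -/
def gegenbauerBoundSmall (lam nu : ℝ) : ℝ :=
  lam * |lam - 1| * (2 : ℝ) ^ lam * Real.Gamma (lam + 1 / 2) / Real.sqrt Real.pi *
    ((3 * nu + 5 * lam - 1) / (3 * (nu + lam - 1))) *
    Real.exp ((1 - lam ^ 2) / (nu + lam - 1))

/-- The constant of the error bound for `lam > 2`; it depends on the number `c > 0` that fixes
the interval `[c / nu, π - c / nu]`. -/
def gegenbauerBoundLarge (lam nu c : ℝ) : ℝ :=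
  lam * (lam - 1) * (2 : ℝ) ^ (3 * lam / 2) * Real.Gamma (lam + 1 / 2) /
      (3 * Real.sqrt Real.pi) *
    ((3 * nu + 2 * lam + 5) / (nu + 1) +
      (Real.pi / (4 * c)) ^ (lam - 2) *
        (Real.Gamma (2 * lam - 1) / Real.Gamma (lam + 1)) *
        ((3 * nu + lam + 7) / (nu - lam + 3)) *
        Real.exp ((2 * lam - 5) * (lam + 1) / (nu - lam + 3)))

end

/-!
Write `N = nu + lam`, `p = lam - 1`. The right Gegenbauer function is first brought into the
Mehler–Dirichlet form, a multiple of `sin^(1 - 2 lam) φ · ∫₀^φ cos (N t) (cos t - cos φ)^p dt`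
(`sin_rpow_mul_rightGegenbauer_eq_integral`). With `y = sin² (t/2)` the factor `cos (N t)` is
`cos (t/2)` times a hypergeometric series in `y`
(`cos_eq_cos_half_mul_ordinaryHypergeometric`); the integral is then a fractional integral of that
series, which raises its lower parameter
(`integral_rpow_mul_ordinaryHypergeometric`), and Euler's transformation
(`ordinaryHypergeometric_euler`) turns the result into the series defining the function.

Next, `cos (N t)` is the real part of `e^{iNt}`, and the segment `[0, φ]` is pushed to `i∞`. The
integrand is real on the imaginary axis, so that only the vertical half-line above `φ` contributes
(`integral_eq_im_vertical`). There
`cos (φ + is) - cos φ = -i sin φ sinh s (1 + i cot φ tanh (s/2))`, and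
`sin^lam φ` times the function becomes a constant times the real part of a unimodular factor times
the Laplace transform, at `N`, of `sinh^p s (1 + i cot φ tanh (s/2))^p`. Replacing this kernel by
its leading part `s^p` produces exactly the cosine term (`abs_remainder_le`).

It remains to estimate the difference of the two kernels pointwise
(`norm_laplaceKernel_sub_le`), using `sinh s ≤ s e^s`, `log (sinh s / s) ≤ s²/2` and
`tanh (s/2) ≤ s/2`. If `lam ≤ 2`, then `|1 + ix|^(lam - 2) ≤ 1`, and the factor `e^s` lost in the
estimate turns the argument of the Laplace transform into `nu + lam - 1`. If `lam > 2`, that power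
grows like `|cot φ tanh (s/2)|^(lam - 2)`;
the distance `c / nu` from the ends of `(0, π)` bounds it by `(π nu s / (4 c))^(lam - 2)`, which
gives the second summand of the constant. Finally `log x ≤ x - 1` exchanges
the shifted arguments of the transforms for `nu`, at the cost of the exponential factors.
-/

open Set Filter Topology MeasureTheory Polynomial

/-! ### The hypergeometric series on the unit interval -/

lemma ascPochhammer_eval_succ_left (a : ℝ) (n : ℕ) :
    (ascPochhammer ℝ (n + 1)).eval a = a * (ascPochhammer ℝ n).eval (a + 1) := by
  rw [ascPochhammer_succ_left]
  simp [eval_comp]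

lemma ordinaryHypergeometricCoefficient_succ (a b c : ℝ) (hc : 0 < c) (n : ℕ) :
    ((n : ℝ) + 1) * (c + n) * ordinaryHypergeometricCoefficient a b c (n + 1) =
      (a + n) * (b + n) * ordinaryHypergeometricCoefficient a b c n := by
  have h1 : ((n : ℝ) + 1) ≠ 0 := by positivity
  have h2 : c + n ≠ 0 := by positivity
  have h3 : (n.factorial : ℝ) ≠ 0 := by positivity
  have h4 : (ascPochhammer ℝ n).eval c ≠ 0 := (ascPochhammer_pos n c hc).ne'
  simp only [ordinaryHypergeometricCoefficient, ascPochhammer_succ_eval, Nat.factorial_succ]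
  push_cast
  field_simp

/-- The coefficients of the termwise derivative are, up to the factor `ab/c`, those of the series
with all three parameters raised by one. -/
lemma succ_mul_ordinaryHypergeometricCoefficient_succ (a b c : ℝ) (hc : 0 < c) (n : ℕ) :
    ((n : ℝ) + 1) * ordinaryHypergeometricCoefficient a b c (n + 1) =
      a * b / c * ordinaryHypergeometricCoefficient (a + 1) (b + 1) (c + 1) n := by
  have h1 : ((n : ℝ) + 1) ≠ 0 := by positivity
  have h3 : (n.factorial : ℝ) ≠ 0 := by positivity
  have h4 : (ascPochhammer ℝ n).eval (c + 1) ≠ 0 := (ascPochhammer_pos n _ (by linarith)).ne'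
  simp only [ordinaryHypergeometricCoefficient, ascPochhammer_eval_succ_left, Nat.factorial_succ]
  push_cast
  field_simp

lemma one_le_radius_ordinaryHypergeometricSeries (a b c : ℝ) (hc : 0 < c) :
    1 ≤ (ordinaryHypergeometricSeries ℝ a b c).radius := by
  by_cases h : ∀ k : ℕ, (k : ℝ) ≠ -a ∧ (k : ℝ) ≠ -b
  · refine (ordinaryHypergeometricSeries_radius_eq_one ℝ a b c fun k => ?_).ge
    refine ⟨(h k).1, (h k).2, ?_⟩
    have : (0 : ℝ) ≤ k := k.cast_nonneg
    linarith
  · push Not at h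
    obtain ⟨k, hk⟩ := h
    by_cases hka : (k : ℝ) = -a
    · obtain rfl : a = -(k : ℝ) := by linarith
      rw [ordinaryHypergeometric_radius_top_of_neg_nat₁]
      exact le_top
    · obtain rfl : b = -(k : ℝ) := by linarith [hk hka]
      rw [ordinaryHypergeometric_radius_top_of_neg_nat₂]
      exact le_top

lemma summable_abs_ordinaryHypergeometricCoefficient (a b c : ℝ) (hc : 0 < c) {x : ℝ}
    (hx : |x| < 1) :
    Summable fun n => |ordinaryHypergeometricCoefficient a b c n * x ^ n| := by
  have h := (ordinaryHypergeometricSeries ℝ a b c).summable_norm_apply (x := x) (by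
    refine Metric.eball_subset_eball (one_le_radius_ordinaryHypergeometricSeries a b c hc) ?_
    rw [mem_eball_zero_iff, ← ofReal_norm, ENNReal.ofReal_lt_one]
    exact hx)
  refine h.congr fun n => ?_
  rw [ordinaryHypergeometricSeries_apply_eq]
  rfl

lemma hasSum_ordinaryHypergeometric (a b c : ℝ) (hc : 0 < c) {x : ℝ} (hx : |x| < 1) :
    HasSum (fun n => ordinaryHypergeometricCoefficient a b c n * x ^ n)
      (ordinaryHypergeometric a b c x) := by
  rw [ordinaryHypergeometric_eq_tsum]
  exact (summable_abs_ordinaryHypergeometricCoefficient a b c hc hx).of_abs.hasSum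

lemma analyticOnNhd_ordinaryHypergeometric (a b c : ℝ) (hc : 0 < c) :
    AnalyticOnNhd ℝ (ordinaryHypergeometric a b c) (Ioo (-1 : ℝ) 1) := by
  have h := (ordinaryHypergeometricSeries ℝ a b c).hasFPowerSeriesOnBall
    (zero_lt_one.trans_le (one_le_radius_ordinaryHypergeometricSeries a b c hc))
  intro x hx
  refine h.analyticAt_of_mem ?_
  refine Metric.eball_subset_eball (one_le_radius_ordinaryHypergeometricSeries a b c hc) ?_
  rw [mem_eball_zero_iff, ← ofReal_norm, ENNReal.ofReal_lt_one]
  exact abs_lt.2 hx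

lemma hasDerivAt_ordinaryHypergeometric (a b c : ℝ) (hc : 0 < c) {x : ℝ} (hx : |x| < 1) :
    HasDerivAt (ordinaryHypergeometric a b c)
      (a * b / c * ordinaryHypergeometric (a + 1) (b + 1) (c + 1) x) x := by
  obtain ⟨r, hxr, hr1⟩ := exists_between hx
  have hr0 : 0 ≤ r := (abs_nonneg x).trans hxr.le
  set A := ordinaryHypergeometricCoefficient a b c with hA
  set A' := ordinaryHypergeometricCoefficient (a + 1) (b + 1) (c + 1) with hA'
  have hsum' : Summable fun n => |a * b / c| * |A' n * r ^ n| :=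
    (summable_abs_ordinaryHypergeometricCoefficient _ _ _ (by linarith)
      (by rwa [abs_of_nonneg hr0])).mul_left _
  have hu : Summable fun n : ℕ => |A n * (n * r ^ (n - 1))| := by
    rw [← summable_nat_add_iff 1]
    refine hsum'.congr fun n => ?_
    rw [← abs_mul, ← mul_assoc, ← succ_mul_ordinaryHypergeometricCoefficient_succ a b c hc]
    congr 1
    rw [Nat.add_sub_cancel]
    push_cast
    ring
  have key := hasDerivAt_tsum_of_isPreconnected (g := fun n y => A n * y ^ n)
    (g' := fun n y => A n * (n * y ^ (n - 1))) hu (isOpen_Ioo (a := -r) (b := r))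
    isPreconnected_Ioo (fun n y _ => (hasDerivAt_pow n y).const_mul _)
    (fun n y hy => by
      rw [Real.norm_eq_abs, abs_mul (A n), abs_mul (A n), abs_mul (n : ℝ), abs_mul (n : ℝ),
        abs_pow, abs_pow, abs_of_nonneg hr0]
      gcongr
      exact (abs_lt.2 hy).le) (abs_lt.1 hxr)
    (summable_abs_ordinaryHypergeometricCoefficient a b c hc hx).of_abs (abs_lt.1 hxr)
  have hf : (fun z => ∑' n, A n * z ^ n) = ordinaryHypergeometric a b c := by
    rw [ordinaryHypergeometric_eq_tsum]; rfl
  rw [hf] at key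
  refine key.congr_deriv (Eq.symm ?_)
  have h2 := (hasSum_ordinaryHypergeometric (a + 1) (b + 1) (c + 1) (by linarith) hx).mul_left
    (a * b / c)
  rw [← h2.tsum_eq]
  have hs : Summable fun n : ℕ => A n * (n * x ^ (n - 1)) := by
    rw [← summable_nat_add_iff 1]
    refine h2.summable.congr fun n => ?_
    rw [← mul_assoc, ← succ_mul_ordinaryHypergeometricCoefficient_succ a b c hc]
    rw [Nat.add_sub_cancel]
    push_cast
    ring
  rw [hs.tsum_eq_zero_add]
  simp only [Nat.cast_zero, zero_mul, mul_zero, zero_add]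
  refine tsum_congr fun n => ?_
  rw [← mul_assoc, ← succ_mul_ordinaryHypergeometricCoefficient_succ a b c hc]
  rw [Nat.add_sub_cancel]
  push_cast
  ring

/-- The hypergeometric equation, the derivatives being written through the raised series. -/
lemma ordinaryHypergeometric_ode (a b c : ℝ) (hc : 0 < c) {x : ℝ} (hx : |x| < 1) :
    x * (1 - x) * (a * b / c * ((a + 1) * (b + 1) / (c + 1) *
        ordinaryHypergeometric (a + 1 + 1) (b + 1 + 1) (c + 1 + 1) x)) +
      (c - (a + b + 1) * x) *
        (a * b / c * ordinaryHypergeometric (a + 1) (b + 1) (c + 1) x) -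
      a * b * ordinaryHypergeometric a b c x = 0 := by
  have hc1 : 0 < c + 1 := by linarith
  set A := ordinaryHypergeometricCoefficient a b c with hA
  have hA1 : ∀ n : ℕ, a * b / c * ordinaryHypergeometricCoefficient (a + 1) (b + 1) (c + 1) n =
      (n + 1) * A (n + 1) := fun n =>
    (succ_mul_ordinaryHypergeometricCoefficient_succ a b c hc n).symm
  have hA2 : ∀ n : ℕ, a * b / c * ((a + 1) * (b + 1) / (c + 1) *
      ordinaryHypergeometricCoefficient (a + 1 + 1) (b + 1 + 1) (c + 1 + 1) n) =
      (n + 1) * ((n + 2) * A (n + 2)) := fun n => by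
    rw [← succ_mul_ordinaryHypergeometricCoefficient_succ (a + 1) (b + 1) (c + 1) hc1 n]
    have := hA1 (n + 1)
    push_cast at this
    rw [mul_left_comm, this]
    ring
  have h0 : HasSum (fun n => A n * x ^ n) _ := hasSum_ordinaryHypergeometric a b c hc hx
  have h1 : HasSum (fun n : ℕ => (n + 1) * A (n + 1) * x ^ n) _ :=
    ((hasSum_ordinaryHypergeometric (a + 1) (b + 1) (c + 1) hc1 hx).mul_left
    (a * b / c)).congr_fun fun n => by rw [← hA1]; ring
  have h2 : HasSum (fun n : ℕ => (n + 1) * ((n + 2) * A (n + 2)) * x ^ n) _ :=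
    (((hasSum_ordinaryHypergeometric (a + 1 + 1) (b + 1 + 1) (c + 1 + 1) (by linarith)
    hx).mul_left ((a + 1) * (b + 1) / (c + 1))).mul_left (a * b / c)).congr_fun
    fun n => by rw [← hA2]; ring
  -- multiplication by `x` shifts the index by one
  have shift : ∀ (B : ℕ → ℝ) (S : ℝ), B 0 = 0 → HasSum (fun n => B (n + 1) * x ^ n) S →
      HasSum (fun n => B n * x ^ n) (x * S) := fun B S hB h => by
    rw [← hasSum_nat_add_iff' 1]
    simpa [hB, pow_succ, mul_assoc, mul_comm, mul_left_comm] using h.mul_left x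
  have h1x := shift (fun n => n * A n) _ (by simp) (h1.congr_fun fun n => by push_cast; ring)
  have h2x := shift (fun n => n * ((n + 1) * A (n + 1))) _ (by simp)
    (h2.congr_fun fun n => by push_cast; ring)
  have h2xx := shift (fun n => (n - 1) * (n * A n)) _ (by simp)
    (h2x.congr_fun fun n => by push_cast; ring)
  have tot := (((h2x.sub h2xx).add (h1.mul_left c)).sub (h1x.mul_left (a + b + 1))).sub
    (h0.mul_left (a * b))
  have hz : ∀ n : ℕ, n * ((n + 1) * A (n + 1)) * x ^ n - (n - 1) * (n * A n) * x ^ n +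
      c * ((n + 1) * A (n + 1) * x ^ n) - (a + b + 1) * (n * A n * x ^ n) -
      a * b * (A n * x ^ n) = 0 := fun n => by
    linear_combination x ^ n * ordinaryHypergeometricCoefficient_succ a b c hc n
  have := tot.unique (hasSum_zero.congr_fun fun n => (hz n))
  linear_combination this

/-! ### Euler's transformation and the cosine -/

/-- A function continuous on `[0, r]` and of zero derivative inside takes equal values at the
ends. -/
lemma eq_of_hasDerivAt_zero {f : ℝ → ℝ} {r : ℝ} (hr : 0 < r) (hf : ContinuousOn f (Icc 0 r))
    (hd : ∀ x ∈ Ioo 0 r, HasDerivAt f 0 x) : f r = f 0 := by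
  obtain ⟨x, -, hx⟩ := exists_hasDerivAt_eq_slope f (fun _ => 0) hr hf hd
  have : r - 0 ≠ 0 := by linarith
  field_simp at hx
  linarith

/-- The two sides of Euler's transformation satisfy the same second-order equation. Abel's formula
for their Wronskian, freed of its powers of `1 - y`, reads `Q = const` for the function `Q` below,
and the constant is `0` because of the factor `y ^ c`. -/
lemma ordinaryHypergeometric_euler_wronskian (a b c : ℝ) (hc : 0 < c) {y : ℝ}
    (hy : y ∈ Ioo (0 : ℝ) 1) :
    (1 - y) * (ordinaryHypergeometric a b c y * ((c - a) * (c - b) / c *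
        ordinaryHypergeometric (c - a + 1) (c - b + 1) (c + 1) y) -
      a * b / c * ordinaryHypergeometric (a + 1) (b + 1) (c + 1) y *
        ordinaryHypergeometric (c - a) (c - b) c y) -
      (c - a - b) * (ordinaryHypergeometric a b c y *
        ordinaryHypergeometric (c - a) (c - b) c y) = 0 := by
  have hc1 : 0 < c + 1 := by linarith
  set f := fun x : ℝ => ordinaryHypergeometric a b c x with hf
  set f1 := fun x : ℝ => a * b / c * ordinaryHypergeometric (a + 1) (b + 1) (c + 1) x with hf1
  set f2 := fun x : ℝ => a * b / c * ((a + 1) * (b + 1) / (c + 1) *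
    ordinaryHypergeometric (a + 1 + 1) (b + 1 + 1) (c + 1 + 1) x) with hf2
  set g := fun x : ℝ => ordinaryHypergeometric (c - a) (c - b) c x with hg
  set g1 := fun x : ℝ => (c - a) * (c - b) / c *
    ordinaryHypergeometric (c - a + 1) (c - b + 1) (c + 1) x with hg1
  set g2 := fun x : ℝ => (c - a) * (c - b) / c * ((c - a + 1) * (c - b + 1) / (c + 1) *
    ordinaryHypergeometric (c - a + 1 + 1) (c - b + 1 + 1) (c + 1 + 1) x) with hg2
  change (1 - y) * (f y * g1 y - f1 y * g y) - (c - a - b) * (f y * g y) = 0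
  have df : ∀ x : ℝ, |x| < 1 → HasDerivAt f (f1 x) x := fun x hx =>
    hasDerivAt_ordinaryHypergeometric a b c hc hx
  have df1 : ∀ x : ℝ, |x| < 1 → HasDerivAt f1 (f2 x) x := fun x hx =>
    (hasDerivAt_ordinaryHypergeometric (a + 1) (b + 1) (c + 1) hc1 hx).const_mul _
  have dg : ∀ x : ℝ, |x| < 1 → HasDerivAt g (g1 x) x := fun x hx =>
    hasDerivAt_ordinaryHypergeometric _ _ c hc hx
  have dg1 : ∀ x : ℝ, |x| < 1 → HasDerivAt g1 (g2 x) x := fun x hx =>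
    (hasDerivAt_ordinaryHypergeometric _ _ (c + 1) hc1 hx).const_mul _
  set Q : ℝ → ℝ := fun x => x ^ c * ((1 - x) * (f x * g1 x - f1 x * g x) -
    (c - a - b) * (f x * g x)) with hQ
  have habs : ∀ x ∈ Icc 0 y, |x| < 1 := fun x hx => by
    rw [abs_of_nonneg hx.1]; exact hx.2.trans_lt hy.2
  have hQd : ∀ x ∈ Ioo 0 y, HasDerivAt Q 0 x := by
    intro x hx
    have hx1 := habs x ⟨hx.1.le, hx.2.le⟩
    have d := (Real.hasDerivAt_rpow_const (p := c) (Or.inl hx.1.ne')).mul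
      ((((hasDerivAt_id x).const_sub 1).mul
        (((df x hx1).mul (dg1 x hx1)).sub ((df1 x hx1).mul (dg x hx1)))).sub
          (((df x hx1).mul (dg x hx1)).const_mul (c - a - b)))
    refine d.congr_deriv ?_
    have ef := ordinaryHypergeometric_ode a b c hc hx1
    have eg := ordinaryHypergeometric_ode (c - a) (c - b) c hc hx1
    change x * (1 - x) * f2 x + (c - (a + b + 1) * x) * f1 x - a * b * f x = 0 at ef
    change x * (1 - x) * g2 x + (c - (c - a + (c - b) + 1) * x) * g1 x -
      (c - a) * (c - b) * g x = 0 at eg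
    have hxc : x ^ c = x * x ^ (c - 1) := by
      rw [Real.rpow_sub_one hx.1.ne']; field_simp [hx.1.ne']
    simp only [Pi.mul_apply, Pi.sub_apply, id]
    rw [hxc]
    linear_combination x ^ (c - 1) * (f x * eg - g x * ef)
  have hcont : ∀ {h h' : ℝ → ℝ}, (∀ x : ℝ, |x| < 1 → HasDerivAt h (h' x) x) →
      ContinuousOn h (Icc 0 y) := fun h x hx =>
    (h x (habs x hx)).continuousAt.continuousWithinAt
  have cf := hcont df
  have cf1 := hcont df1
  have cg := hcont dg
  have cg1 := hcont dg1
  have hQc : ContinuousOn Q (Icc 0 y) := by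
    refine ContinuousOn.mul (continuousOn_id.rpow_const fun x _ => Or.inr hc.le) ?_
    fun_prop
  have h0 := eq_of_hasDerivAt_zero hy.1 hQc hQd
  have hQ0 : Q 0 = 0 := by simp [hQ, Real.zero_rpow hc.ne']
  rw [hQ0] at h0
  exact (mul_eq_zero.1 h0).resolve_left (Real.rpow_pos_of_pos hy.1 c).ne'

/-- Euler's transformation of the hypergeometric series. -/
lemma ordinaryHypergeometric_euler (a b c : ℝ) (hc : 0 < c) {y : ℝ} (hy : y ∈ Ioo (-1 : ℝ) 1) :
    ordinaryHypergeometric a b c y =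
      (1 - y) ^ (c - a - b) * ordinaryHypergeometric (c - a) (c - b) c y := by
  set f := fun x : ℝ => ordinaryHypergeometric a b c x with hf
  set g := fun x : ℝ => ordinaryHypergeometric (c - a) (c - b) c x with hg
  set p := c - a - b with hp
  have df : ∀ x : ℝ, |x| < 1 → HasDerivAt f _ x := fun x hx =>
    hasDerivAt_ordinaryHypergeometric a b c hc hx
  have dg : ∀ x : ℝ, |x| < 1 → HasDerivAt g _ x := fun x hx =>
    hasDerivAt_ordinaryHypergeometric (c - a) (c - b) c hc hx
  have af : AnalyticOnNhd ℝ f (Ioo (-1) 1) := analyticOnNhd_ordinaryHypergeometric a b c hc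
  have ag : AnalyticOnNhd ℝ g (Ioo (-1) 1) := analyticOnNhd_ordinaryHypergeometric _ _ c hc
  have apow : AnalyticOnNhd ℝ (fun x : ℝ => Real.exp (Real.log (1 - x) * p)) (Ioo (-1) 1) := by
    intro x hx
    refine AnalyticAt.rexp' (AnalyticAt.mul (AnalyticAt.log (by fun_prop) ?_) analyticAt_const)
    simpa using hx.2
  have hpow : ∀ x ∈ Ioo (-1 : ℝ) 1, (1 - x) ^ p = Real.exp (Real.log (1 - x) * p) :=
    fun x hx => Real.rpow_def_of_pos (by linarith [hx.2]) p
  have h0 : ∀ᶠ x in 𝓝 (0 : ℝ), f x ≠ 0 := by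
    refine (af 0 (by norm_num)).continuousAt.eventually_ne ?_
    simp [hf, ordinaryHypergeometric_zero]
  obtain ⟨δ, hδ, hδf⟩ := Metric.eventually_nhds_iff.1 h0
  have hloc : ∀ r, 0 < r → r < δ → r < 1 → f r = Real.exp (Real.log (1 - r) * p) * g r := by
    intro r hr hrδ hr1
    have hne : ∀ x ∈ Icc 0 r, f x ≠ 0 := fun x hx => hδf (by
      rw [Real.dist_eq, sub_zero, abs_of_nonneg hx.1]; linarith [hx.2])
    have habs : ∀ x ∈ Icc 0 r, |x| < 1 := fun x hx => by
      rw [abs_of_nonneg hx.1]; linarith [hx.2]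
    have hd : ∀ x ∈ Icc 0 r, HasDerivAt (fun x => (1 - x) ^ p * g x / f x) _ x := fun x hx =>
      ((((hasDerivAt_id x).const_sub 1).rpow_const (p := p)
        (Or.inl (by have := hx.2; simp only [id]; linarith))).mul (dg x (habs x hx))).div
          (df x (habs x hx)) (hne x hx)
    have := eq_of_hasDerivAt_zero hr
      (fun x hx => (hd x hx).continuousAt.continuousWithinAt) (fun x hx => by
        have hx' : x ∈ Icc 0 r := ⟨hx.1.le, hx.2.le⟩
        refine (hd x hx').congr_deriv ?_
        have w := ordinaryHypergeometric_euler_wronskian a b c hc (y := x)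
          ⟨hx.1, hx.2.trans hr1⟩
        have h1x : 0 < 1 - x := by linarith [hx.2]
        rw [div_eq_zero_iff]
        left
        simp only [Pi.mul_apply, id]
        have hxc : (1 - x) ^ p = (1 - x) * (1 - x) ^ (p - 1) := by
          rw [Real.rpow_sub_one h1x.ne']; field_simp
        rw [hxc]
        linear_combination (1 - x) ^ (p - 1) * w)
    have hf0 : f 0 = 1 := ordinaryHypergeometric_zero a b c
    have hg0 : g 0 = 1 := ordinaryHypergeometric_zero _ _ c
    rw [hf0, hg0] at this
    have hfr := hne r ⟨hr.le, le_rfl⟩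
    rw [← hpow r ⟨by linarith, hr1⟩]
    simp only [sub_zero, Real.one_rpow, mul_one, div_one] at this
    field_simp at this
    exact this.symm
  have hfreq : ∃ᶠ x in 𝓝[≠] (0 : ℝ), f x = Real.exp (Real.log (1 - x) * p) * g x := by
    have hev : ∀ᶠ x in 𝓝[>] (0 : ℝ), f x = Real.exp (Real.log (1 - x) * p) * g x := by
      filter_upwards [Ioo_mem_nhdsGT (lt_min hδ zero_lt_one)] with x hx
      exact hloc x hx.1 (hx.2.trans_le (min_le_left _ _)) (hx.2.trans_le (min_le_right _ _))
    exact hev.frequently.filter_mono (nhdsWithin_mono _ fun x hx => (ne_of_gt hx))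
  have := af.eqOn_of_preconnected_of_frequently_eq (apow.mul ag) isPreconnected_Ioo
    (by norm_num : (0 : ℝ) ∈ Ioo (-1 : ℝ) 1) hfreq hy
  change f y = (1 - y) ^ p * g y
  rw [hpow y hy]
  exact this

/-- `cos (N t) = cos (t/2) ₂F₁(1/2 + N, 1/2 - N; 1/2; sin² (t/2))`: by the hypergeometric equation,
the right-hand side `u` satisfies `u'' = -N² u`. -/
lemma cos_eq_cos_half_mul_ordinaryHypergeometric (N : ℝ) (hN : 0 < N) {t : ℝ} (ht0 : 0 < t)
    (htpi : t < Real.pi) :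
    Real.cos (N * t) = Real.cos (t / 2) *
      ordinaryHypergeometric (1 / 2 + N) (1 / 2 - N) (1 / 2) (Real.sin (t / 2) ^ 2) := by
  set F := fun x : ℝ => ordinaryHypergeometric (1 / 2 + N) (1 / 2 - N) (1 / 2) x with hF
  set F1 := fun x : ℝ => (1 / 2 + N) * (1 / 2 - N) / (1 / 2) *
    ordinaryHypergeometric (1 / 2 + N + 1) (1 / 2 - N + 1) (1 / 2 + 1) x with hF1
  set F2 := fun x : ℝ => (1 / 2 + N) * (1 / 2 - N) / (1 / 2) *
    ((1 / 2 + N + 1) * (1 / 2 - N + 1) / (1 / 2 + 1) *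
    ordinaryHypergeometric (1 / 2 + N + 1 + 1) (1 / 2 - N + 1 + 1) (1 / 2 + 1 + 1) x) with hF2
  have dF : ∀ x : ℝ, |x| < 1 → HasDerivAt F (F1 x) x := fun x hx =>
    hasDerivAt_ordinaryHypergeometric _ _ _ (by norm_num) hx
  have dF1 : ∀ x : ℝ, |x| < 1 → HasDerivAt F1 (F2 x) x := fun x hx =>
    (hasDerivAt_ordinaryHypergeometric _ _ _ (by norm_num) hx).const_mul _
  set s := fun x : ℝ => Real.sin (x / 2) with hs
  set c := fun x : ℝ => Real.cos (x / 2) with hcdef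
  have ds : ∀ x, HasDerivAt s (c x / 2) x := fun x => by
    have := (Real.hasDerivAt_sin (x / 2)).comp x ((hasDerivAt_id x).div_const 2)
    exact this.congr_deriv (by simp [hcdef]; ring)
  have dc : ∀ x, HasDerivAt c (-s x / 2) x := fun x => by
    have := (Real.hasDerivAt_cos (x / 2)).comp x ((hasDerivAt_id x).div_const 2)
    exact this.congr_deriv (by simp [hs]; ring)
  have hsc : ∀ x, s x ^ 2 + c x ^ 2 = 1 := fun x => Real.sin_sq_add_cos_sq _
  have habs : ∀ x ∈ Icc 0 t, |s x ^ 2| < 1 := fun x hx => by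
    rw [abs_of_nonneg (sq_nonneg _)]
    have : 0 < c x := Real.cos_pos_of_mem_Ioo ⟨by linarith [hx.1, Real.pi_pos], by linarith [hx.2]⟩
    nlinarith [hsc x]
  have dsq : ∀ x, HasDerivAt (fun x => s x ^ 2) (s x * c x) x := fun x =>
    ((ds x).pow 2).congr_deriv (by push_cast; ring)
  have dFs : ∀ x ∈ Icc 0 t, HasDerivAt (fun x => F (s x ^ 2)) (F1 (s x ^ 2) * (s x * c x)) x :=
    fun x hx => HasDerivAt.comp (h₂ := F) x (dF _ (habs x hx)) (dsq x)
  have dF1s : ∀ x ∈ Icc 0 t, HasDerivAt (fun x => F1 (s x ^ 2)) (F2 (s x ^ 2) * (s x * c x)) x :=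
    fun x hx => HasDerivAt.comp (h₂ := F1) x (dF1 _ (habs x hx)) (dsq x)
  set u := fun x : ℝ => c x * F (s x ^ 2) with hu
  set u' := fun x : ℝ => -s x / 2 * F (s x ^ 2) + c x ^ 2 * s x * F1 (s x ^ 2) with hu'
  have du : ∀ x ∈ Icc 0 t, HasDerivAt u (u' x) x := fun x hx =>
    ((dc x).mul (dFs x hx)).congr_deriv (by simp only [hu']; ring)
  have du' : ∀ x ∈ Icc 0 t, HasDerivAt u' (-(N ^ 2) * u x) x := fun x hx => by
    have d := (((ds x).neg.div_const 2).mul (dFs x hx)).add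
      ((((dc x).pow 2).mul (ds x)).mul (dF1s x hx))
    refine d.congr_deriv ?_
    have e := ordinaryHypergeometric_ode (1 / 2 + N) (1 / 2 - N) (1 / 2) (by norm_num) (habs x hx)
    change s x ^ 2 * (1 - s x ^ 2) * F2 (s x ^ 2) +
      (1 / 2 - (1 / 2 + N + (1 / 2 - N) + 1) * s x ^ 2) * F1 (s x ^ 2) -
      (1 / 2 + N) * (1 / 2 - N) * F (s x ^ 2) = 0 at e
    have h1 : c x ^ 2 = 1 - s x ^ 2 := by linarith [hsc x]
    have h1' : s x ^ 2 = 1 - c x ^ 2 := by linarith [hsc x]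
    simp only [hu, Pi.mul_apply, Pi.pow_apply, Pi.neg_apply]
    generalize F (s x ^ 2) = A at *
    generalize F1 (s x ^ 2) = B at *
    generalize F2 (s x ^ 2) = C at *
    push_cast
    linear_combination c x * e + (c x * s x ^ 2 * C + c x * B / 2) * h1
  have dcos : ∀ x, HasDerivAt (fun x => Real.cos (N * x)) (-(N * Real.sin (N * x))) x := fun x =>
    ((Real.hasDerivAt_cos _).comp x ((hasDerivAt_id x).const_mul N)).congr_deriv (by simp; ring)
  have dsin : ∀ x, HasDerivAt (fun x => Real.sin (N * x)) (N * Real.cos (N * x)) x := fun x =>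
    ((Real.hasDerivAt_sin _).comp x ((hasDerivAt_id x).const_mul N)).congr_deriv (by simp; ring)
  have d1 : ∀ x ∈ Icc 0 t, HasDerivAt
      (fun x => u' x * Real.cos (N * x) + N * (u x * Real.sin (N * x))) 0 x := fun x hx =>
    (((du' x hx).mul (dcos x)).add (((du x hx).mul (dsin x)).const_mul N)).congr_deriv (by ring)
  have d2 : ∀ x ∈ Icc 0 t, HasDerivAt
      (fun x => u' x * Real.sin (N * x) - N * (u x * Real.cos (N * x))) 0 x := fun x hx =>
    (((du' x hx).mul (dsin x)).sub (((du x hx).mul (dcos x)).const_mul N)).congr_deriv (by ring)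
  have e1 := eq_of_hasDerivAt_zero ht0
    (fun x hx => (d1 x hx).continuousAt.continuousWithinAt) fun x hx => d1 x ⟨hx.1.le, hx.2.le⟩
  have e2 := eq_of_hasDerivAt_zero ht0
    (fun x hx => (d2 x hx).continuousAt.continuousWithinAt) fun x hx => d2 x ⟨hx.1.le, hx.2.le⟩
  have hF0 : F 0 = 1 := ordinaryHypergeometric_zero _ _ _
  have hu0 : u 0 = 1 := by simp [hu, hs, hcdef, hF0]
  have hu'0 : u' 0 = 0 := by simp [hu', hs]
  simp only [hu0, hu'0, mul_zero, Real.sin_zero, Real.cos_zero] at e1 e2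
  change Real.cos (N * t) = u t
  have := Real.sin_sq_add_cos_sq (N * t)
  refine mul_left_cancel₀ hN.ne' ?_
  linear_combination Real.cos (N * t) * e2 - Real.sin (N * t) * e1 + N * u t * this

/-! ### Bateman's integral and the Mehler–Dirichlet formula -/

lemma integral_rpow_mul_sub_rpow {s t Y : ℝ} (hs : 0 < s) (ht : 0 < t) (hY : 0 < Y) :
    ∫ x in Ioo 0 Y, x ^ (s - 1) * (Y - x) ^ (t - 1) =
      Real.Gamma s * Real.Gamma t / Real.Gamma (s + t) * Y ^ (s + t - 1) := by
  have h := Complex.betaIntegral_scaled (s : ℂ) (t : ℂ) hY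
  rw [Complex.betaIntegral_eq_Gamma_mul_div _ _ (by simpa) (by simpa),
    intervalIntegral.integral_of_le hY.le, integral_Ioc_eq_integral_Ioo] at h
  apply Complex.ofReal_injective
  rw [← integral_complex_ofReal]
  push_cast
  rw [← Complex.Gamma_ofReal, ← Complex.Gamma_ofReal, ← Complex.Gamma_ofReal,
    Complex.ofReal_cpow hY.le]
  push_cast
  rw [mul_comm, ← h]
  refine setIntegral_congr_fun measurableSet_Ioo fun x hx => ?_
  rw [Complex.ofReal_cpow hx.1.le, Complex.ofReal_cpow (by linarith [hx.2])]
  push_cast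
  rfl

lemma integrableOn_rpow_mul_sub_rpow {s t Y : ℝ} (hs : 0 < s) (ht : 0 < t) (hY : 0 < Y) :
    IntegrableOn (fun x => x ^ (s - 1) * (Y - x) ^ (t - 1)) (Ioo 0 Y) := by
  -- a non-integrable function would have integral `0`
  refine not_imp_comm.1 integral_undef ?_
  rw [integral_rpow_mul_sub_rpow hs ht hY]
  have := Real.Gamma_pos_of_pos hs
  have := Real.Gamma_pos_of_pos ht
  have := Real.Gamma_pos_of_pos (add_pos hs ht)
  positivity

lemma Real.Gamma_add_nat_eq_ascPochhammer {c : ℝ} (hc : 0 < c) (n : ℕ) :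
    Real.Gamma (c + n) = (ascPochhammer ℝ n).eval c * Real.Gamma c := by
  induction n with
  | zero => simp
  | succ n ih =>
    have : c + n ≠ 0 := by positivity
    push_cast
    rw [← add_assoc, Real.Gamma_add_one this, ih, ascPochhammer_succ_eval]
    ring

/-- Bateman's integral: a fractional integration of order `μ` raises the lower parameter of the
hypergeometric series by `μ`. -/
lemma integral_rpow_mul_ordinaryHypergeometric (a b : ℝ) {c μ Y : ℝ} (hc : 0 < c) (hμ : 0 < μ)
    (hY : 0 < Y) (hY1 : Y < 1) :
    ∫ y in Ioo 0 Y, ordinaryHypergeometric a b c y * (y ^ (c - 1) * (Y - y) ^ (μ - 1)) =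
      Real.Gamma c * Real.Gamma μ / Real.Gamma (c + μ) * Y ^ (c + μ - 1) *
        ordinaryHypergeometric a b (c + μ) Y := by
  have hYabs : |Y| < 1 := by rwa [abs_of_pos hY]
  have hint := integrableOn_rpow_mul_sub_rpow hc hμ hY
  have key := hasSum_integral_of_dominated_convergence (μ := volume.restrict (Ioo 0 Y))
    (F := fun (n : ℕ) y => ordinaryHypergeometricCoefficient a b c n * y ^ n *
      (y ^ (c - 1) * (Y - y) ^ (μ - 1)))
    (f := fun y => ordinaryHypergeometric a b c y * (y ^ (c - 1) * (Y - y) ^ (μ - 1)))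
    (fun n y => |ordinaryHypergeometricCoefficient a b c n * Y ^ n| *
      (y ^ (c - 1) * (Y - y) ^ (μ - 1)))
    (fun n => ((by fun_prop : Continuous fun y : ℝ =>
      ordinaryHypergeometricCoefficient a b c n * y ^ n).aestronglyMeasurable).mul hint.1)
    (fun n => by
      refine (ae_restrict_iff' measurableSet_Ioo).2 (ae_of_all _ fun y hy => ?_)
      have h1 : 0 ≤ y ^ (c - 1) * (Y - y) ^ (μ - 1) :=
        mul_nonneg (Real.rpow_nonneg hy.1.le _) (Real.rpow_nonneg (by linarith [hy.2]) _)
      rw [Real.norm_eq_abs, abs_mul _ (y ^ (c - 1) * (Y - y) ^ (μ - 1)), abs_of_nonneg h1]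
      refine mul_le_mul_of_nonneg_right ?_ h1
      rw [abs_mul _ (y ^ n), abs_mul _ (Y ^ n), abs_pow, abs_pow, abs_of_pos hy.1, abs_of_pos hY]
      gcongr
      · exact hy.1.le
      · exact hy.2.le)
    (ae_of_all _ fun y =>
      (summable_abs_ordinaryHypergeometricCoefficient a b c hc hYabs).mul_right _)
    (by simp_rw [tsum_mul_right]; exact hint.const_mul _)
    (by
      refine (ae_restrict_iff' measurableSet_Ioo).2 (ae_of_all _ fun y hy => ?_)
      refine (hasSum_ordinaryHypergeometric a b c hc ?_).mul_right _
      rw [abs_of_pos hy.1]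
      exact hy.2.trans hY1)
  refine key.unique ?_
  refine ((hasSum_ordinaryHypergeometric a b (c + μ) (by linarith) hYabs).mul_left _).congr_fun
    fun n => ?_
  have hcn : 0 < c + n := by positivity
  have e : ∫ y in Ioo 0 Y, ordinaryHypergeometricCoefficient a b c n * y ^ n *
      (y ^ (c - 1) * (Y - y) ^ (μ - 1)) = ordinaryHypergeometricCoefficient a b c n *
      ∫ y in Ioo 0 Y, y ^ (c + n - 1) * (Y - y) ^ (μ - 1) := by
    rw [← integral_const_mul]
    refine setIntegral_congr_fun measurableSet_Ioo fun y hy => ?_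
    have : y ^ (c + n - 1) = y ^ (c - 1) * y ^ n := by
      rw [← Real.rpow_natCast, ← Real.rpow_add hy.1]; congr 1; ring
    rw [this]
    ring
  rw [e, integral_rpow_mul_sub_rpow hcn hμ hY, Real.Gamma_add_nat_eq_ascPochhammer hc,
    show c + n + μ = c + μ + n by ring, Real.Gamma_add_nat_eq_ascPochhammer (by positivity),
    show c + μ + n - 1 = (c + μ - 1) + n by ring, Real.rpow_add hY, Real.rpow_natCast]
  have h1 := (ascPochhammer_pos n c hc).ne'
  have h2 := (ascPochhammer_pos n (c + μ) (by linarith)).ne'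
  have h3 := (Real.Gamma_pos_of_pos (add_pos hc hμ)).ne'
  simp only [ordinaryHypergeometricCoefficient]
  field_simp

lemma cos_sub_cos_eq_sin_half_sq (t φ : ℝ) :
    Real.cos t - Real.cos φ = 2 * (Real.sin (φ / 2) ^ 2 - Real.sin (t / 2) ^ 2) := by
  have h1 := Real.cos_sq' (t / 2)
  have h2 := Real.cos_sq' (φ / 2)
  have h3 := Real.cos_two_mul (t / 2)
  have h4 := Real.cos_two_mul (φ / 2)
  rw [mul_div_cancel₀ _ (two_ne_zero)] at h3 h4
  linarith

/-- The substitution `y = sin² (t/2)` on `(0, φ)`. -/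
lemma sin_half_sq_image {φ : ℝ} (h0 : 0 < φ) (hpi : φ < Real.pi) :
    InjOn (fun t => Real.sin (t / 2) ^ 2) (Ioo 0 φ) ∧
    (fun t => Real.sin (t / 2) ^ 2) '' Ioo 0 φ = Ioo 0 (Real.sin (φ / 2) ^ 2) := by
  have hmono : StrictMonoOn (fun t => Real.sin (t / 2) ^ 2) (Icc 0 φ) := by
    intro x hx y hy hxy
    have h1 : Real.sin (x / 2) < Real.sin (y / 2) :=
      Real.sin_lt_sin_of_lt_of_le_pi_div_two (by linarith [hx.1, Real.pi_pos])
        (by linarith [hy.2]) (by linarith)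
    have h2 : 0 ≤ Real.sin (x / 2) :=
      Real.sin_nonneg_of_nonneg_of_le_pi (by linarith [hx.1]) (by linarith [hx.2])
    simp only
    gcongr
  refine ⟨hmono.injOn.mono Ioo_subset_Icc_self, ?_⟩
  apply Subset.antisymm
  · rintro _ ⟨t, ht, rfl⟩
    have a := hmono ⟨le_rfl, h0.le⟩ ⟨ht.1.le, ht.2.le⟩ ht.1
    have b := hmono ⟨ht.1.le, ht.2.le⟩ ⟨h0.le, le_rfl⟩ ht.2
    simp only [zero_div, Real.sin_zero] at a
    exact ⟨by simpa using a, b⟩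
  · have := intermediate_value_Ioo (f := fun t => Real.sin (t / 2) ^ 2) h0.le
      (by fun_prop)
    simpa using this

/-- The integrand of the Mehler–Dirichlet formula is the pullback, under `y = sin² (t/2)`, of an
integrand of Bateman type. -/
lemma mehlerDirichlet_integrand_eq (N p : ℝ) (hN : 0 < N) {φ t : ℝ} (hpi : φ < Real.pi)
    (ht : t ∈ Ioo 0 φ) :
    Real.cos (N * t) * (Real.cos t - Real.cos φ) ^ p =
      |Real.sin (t / 2) * Real.cos (t / 2)| • (2 ^ p *
        (ordinaryHypergeometric (1 / 2 + N) (1 / 2 - N) (1 / 2) (Real.sin (t / 2) ^ 2) *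
        ((Real.sin (t / 2) ^ 2) ^ ((1 : ℝ) / 2 - 1) *
          (Real.sin (φ / 2) ^ 2 - Real.sin (t / 2) ^ 2) ^ p))) := by
  have hs : 0 < Real.sin (t / 2) :=
    Real.sin_pos_of_pos_of_lt_pi (by linarith [ht.1]) (by linarith [ht.1, ht.2])
  have hc : 0 < Real.cos (t / 2) :=
    Real.cos_pos_of_mem_Ioo ⟨by linarith [ht.1, Real.pi_pos], by linarith [ht.2]⟩
  have hd : 0 ≤ Real.sin (φ / 2) ^ 2 - Real.sin (t / 2) ^ 2 := by
    have h1 : Real.cos φ ≤ Real.cos t :=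
      Real.cos_le_cos_of_nonneg_of_le_pi ht.1.le hpi.le ht.2.le
    have := cos_sub_cos_eq_sin_half_sq t φ
    linarith
  have hpow : (Real.sin (t / 2) ^ 2) ^ ((1 : ℝ) / 2 - 1) = (Real.sin (t / 2))⁻¹ := by
    rw [← Real.rpow_natCast, ← Real.rpow_mul hs.le, ← Real.rpow_neg_one]
    norm_num
  rw [cos_eq_cos_half_mul_ordinaryHypergeometric N hN ht.1 (ht.2.trans hpi),
    cos_sub_cos_eq_sin_half_sq, Real.mul_rpow two_pos.le hd, hpow, abs_of_pos (mul_pos hs hc),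
    smul_eq_mul]
  field_simp

lemma hasDerivAt_sin_half_sq (t : ℝ) :
    HasDerivAt (fun t => Real.sin (t / 2) ^ 2) (Real.sin (t / 2) * Real.cos (t / 2)) t := by
  have := ((Real.hasDerivAt_sin (t / 2)).comp t ((hasDerivAt_id t).div_const 2)).pow 2
  refine this.congr_deriv ?_
  simp only [Function.comp_apply, id]
  push_cast
  ring

lemma integrableOn_mehlerDirichlet {N lam φ : ℝ} (hN : 0 < N) (hlam : 0 < lam) (h0 : 0 < φ)
    (hpi : φ < Real.pi) :
    IntegrableOn (fun t => Real.cos (N * t) * (Real.cos t - Real.cos φ) ^ (lam - 1))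
      (Ioo 0 φ) := by
  obtain ⟨hinj, himg⟩ := sin_half_sq_image h0 hpi
  have hs : 0 < Real.sin (φ / 2) := Real.sin_pos_of_pos_of_lt_pi (by linarith) (by linarith)
  have hc : 0 < Real.cos (φ / 2) := Real.cos_pos_of_mem_Ioo ⟨by linarith, by linarith⟩
  have hY1 : Real.sin (φ / 2) ^ 2 < 1 := by nlinarith [Real.sin_sq_add_cos_sq (φ / 2)]
  refine IntegrableOn.congr_fun ?_ (fun t ht =>
    (mehlerDirichlet_integrand_eq N (lam - 1) hN hpi ht).symm) measurableSet_Ioo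
  have hiff := integrableOn_image_iff_integrableOn_abs_deriv_smul measurableSet_Ioo
    (fun t _ => (hasDerivAt_sin_half_sq t).hasDerivWithinAt) hinj
    (fun y => 2 ^ (lam - 1) * (ordinaryHypergeometric (1 / 2 + N) (1 / 2 - N) (1 / 2) y *
        (y ^ ((1 : ℝ) / 2 - 1) * (Real.sin (φ / 2) ^ 2 - y) ^ (lam - 1))))
  refine hiff.1 ?_
  rw [himg]
  refine Integrable.const_mul ?_ _
  rw [← IntegrableOn]
  have hk := integrableOn_rpow_mul_sub_rpow (s := 1 / 2) (by norm_num) hlam (pow_pos hs 2)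
  have hcont : ContinuousOn (ordinaryHypergeometric (1 / 2 + N) (1 / 2 - N) (1 / 2 : ℝ))
      (Icc 0 (Real.sin (φ / 2) ^ 2)) := fun y hy =>
    (hasDerivAt_ordinaryHypergeometric _ _ _ (by norm_num)
      (by rw [abs_of_nonneg hy.1]; exact hy.2.trans_lt hY1)).continuousAt.continuousWithinAt
  rw [← integrableOn_Icc_iff_integrableOn_Ioo] at hk ⊢
  exact hk.continuousOn_mul hcont isCompact_Icc

/-- The Mehler–Dirichlet formula for the right Gegenbauer function. -/
lemma sin_rpow_mul_rightGegenbauer_eq_integral {lam nu φ : ℝ} (hlam : 0 < lam) (hnu : 0 < nu)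
    (h0 : 0 < φ) (hpi : φ < Real.pi) :
    Real.sin φ ^ (2 * lam - 1) * rightGegenbauer lam nu (Real.cos φ) =
      2 ^ lam * Real.Gamma (lam + 1 / 2) / (Real.sqrt Real.pi * Real.Gamma lam) *
        ∫ t in Ioo 0 φ, Real.cos ((nu + lam) * t) * (Real.cos t - Real.cos φ) ^ (lam - 1) := by
  obtain ⟨hinj, himg⟩ := sin_half_sq_image h0 hpi
  set N := nu + lam with hN
  have hN0 : 0 < N := by positivity
  have hs : 0 < Real.sin (φ / 2) := Real.sin_pos_of_pos_of_lt_pi (by linarith) (by linarith)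
  have hc : 0 < Real.cos (φ / 2) := Real.cos_pos_of_mem_Ioo ⟨by linarith, by linarith⟩
  have hsc := Real.sin_sq_add_cos_sq (φ / 2)
  set Y := Real.sin (φ / 2) ^ 2 with hY
  have hY0 : 0 < Y := by positivity
  have hY1 : Y < 1 := by nlinarith
  rw [setIntegral_congr_fun measurableSet_Ioo fun t ht =>
    mehlerDirichlet_integrand_eq N (lam - 1) hN0 hpi ht]
  have hsub := integral_image_eq_integral_abs_deriv_smul measurableSet_Ioo
    (fun t _ => (hasDerivAt_sin_half_sq t).hasDerivWithinAt) hinj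
    (fun y => 2 ^ (lam - 1) * (ordinaryHypergeometric (1 / 2 + N) (1 / 2 - N) (1 / 2) y *
        (y ^ ((1 : ℝ) / 2 - 1) * (Y - y) ^ (lam - 1))))
  rw [← hsub, himg, integral_const_mul,
    integral_rpow_mul_ordinaryHypergeometric _ _ (by norm_num) hlam hY0 hY1,
    ordinaryHypergeometric_euler _ _ _ (by positivity) ⟨by linarith, hY1⟩, rightGegenbauer,
    Real.Gamma_one_half_eq]
  have hx : (1 - Real.cos φ) / 2 = Y := by
    have := cos_sub_cos_eq_sin_half_sq 0 φ
    simp at this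
    linarith
  have e1 : 1 / 2 + lam - (1 / 2 + N) = -nu := by rw [hN]; ring
  have e2 : 1 / 2 + lam - (1 / 2 - N) = nu + 2 * lam := by rw [hN]; ring
  have e3 : -nu - (1 / 2 - N) = lam - 1 / 2 := by rw [hN]; ring
  have e4 : (1 : ℝ) / 2 + lam - 1 = lam - 1 / 2 := by ring
  rw [hx, e1, e2, e3, e4, add_comm (1 / 2 : ℝ) lam]
  have h1Y : 0 < 1 - Y := by linarith
  have hsin : Real.sin φ ^ (2 * lam - 1) = 2 ^ (2 * lam - 1) *
      (Y ^ (lam - 1 / 2) * (1 - Y) ^ (lam - 1 / 2)) := by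
    have h1 : Real.sin φ = 2 * (Real.sin (φ / 2) * Real.cos (φ / 2)) := by
      have := Real.sin_two_mul (φ / 2)
      rw [mul_div_cancel₀ _ (two_ne_zero)] at this
      linarith
    have h2 : 1 - Y = Real.cos (φ / 2) ^ 2 := by linarith
    rw [h1, Real.mul_rpow two_pos.le (by positivity), Real.mul_rpow hs.le hc.le, h2, hY,
      ← Real.rpow_natCast, ← Real.rpow_natCast, ← Real.rpow_mul hs.le, ← Real.rpow_mul hc.le]
    congr 3 <;> push_cast <;> ring
  have hg := Real.Gamma_pos_of_pos hlam
  have hg' := Real.Gamma_pos_of_pos (show 0 < lam + 1 / 2 by positivity)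
  have hpi' := Real.sqrt_pos.2 Real.pi_pos
  have h2 : (2 : ℝ) ^ (2 * lam - 1) = 2 ^ lam * 2 ^ (lam - 1) := by
    rw [← Real.rpow_add two_pos]; congr 1; ring
  rw [hsin, h2]
  field_simp

/-! ### Shifting the contour to a vertical half-line -/

lemma integrableOn_rpow_mul_exp_neg_mul {s r : ℝ} (hs : -1 < s) (hr : 0 < r) :
    IntegrableOn (fun t : ℝ => t ^ s * Real.exp (-(r * t))) (Ioi 0) := by
  have h := Real.integral_rpow_mul_exp_neg_mul_Ioi (a := s + 1) (r := r) (by linarith) hr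
  rw [add_sub_cancel_right] at h
  -- a non-integrable function would have integral `0`
  refine not_imp_comm.1 integral_undef ?_
  rw [h]
  have := Real.Gamma_pos_of_pos (show 0 < s + 1 by linarith)
  positivity

lemma rpow_le_add_of_mem_Icc {a b w : ℝ} (p : ℝ) (ha : 0 < a) (haw : a ≤ w) (hwb : w ≤ b) :
    w ^ p ≤ a ^ p + b ^ p := by
  have hw : 0 < w := ha.trans_le haw
  rcases le_total 0 p with hp | hp
  · have := Real.rpow_le_rpow hw.le hwb hp
    have := Real.rpow_nonneg ha.le p
    linarith
  · have := Real.rpow_le_rpow_of_nonpos ha haw hp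
    have := Real.rpow_nonneg (hw.le.trans hwb) p
    linarith

/-- The holomorphic integrand `e^{iNz} (cos z - cos φ)^p`. On the half-strip above `[0, φ]` the
base stays in the slit plane, so the principal power is holomorphic there. -/
noncomputable def contourIntegrand (N p φ : ℝ) (z : ℂ) : ℂ :=
  Complex.exp (Complex.I * N * z) * (Complex.cos z - Real.cos φ) ^ (p : ℂ)

lemma cos_sub_cos_re (φ x y : ℝ) :
    (Complex.cos (x + y * Complex.I) - Real.cos φ).re =
      Real.cos x * Real.cosh y - Real.cos φ := by
  rw [Complex.cos_add_mul_I, ← Complex.ofReal_cos, ← Complex.ofReal_sin, ← Complex.ofReal_cosh,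
    ← Complex.ofReal_sinh]
  simp [-Complex.ofReal_cos, -Complex.ofReal_sin, -Complex.ofReal_cosh, -Complex.ofReal_sinh]

lemma cos_sub_cos_im (φ x y : ℝ) :
    (Complex.cos (x + y * Complex.I) - Real.cos φ).im = -(Real.sin x * Real.sinh y) := by
  rw [Complex.cos_add_mul_I, ← Complex.ofReal_cos, ← Complex.ofReal_sin, ← Complex.ofReal_cosh,
    ← Complex.ofReal_sinh]
  simp [-Complex.ofReal_cos, -Complex.ofReal_sin, -Complex.ofReal_cosh, -Complex.ofReal_sinh]

lemma cos_sub_cos_mem_slitPlane {φ x y : ℝ} (hpi : φ < Real.pi) (hx0 : 0 ≤ x) (hxφ : x ≤ φ)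
    (hy : 0 ≤ y) (h : x < φ ∨ 0 < y) :
    Complex.cos (x + y * Complex.I) - Real.cos φ ∈ Complex.slitPlane := by
  rw [Complex.mem_slitPlane_iff, cos_sub_cos_re, cos_sub_cos_im]
  rcases hy.eq_or_lt with rfl | hy
  · left
    have hlt : x < φ := by simpa using h
    have := Real.cos_lt_cos_of_nonneg_of_le_pi hx0 hpi.le hlt
    simpa using this
  · rcases hx0.eq_or_lt with rfl | hx0
    · left
      have h1 : 1 < Real.cosh y := Real.one_lt_cosh.2 hy.ne'
      have := Real.cos_le_one φ
      simp only [Real.cos_zero, one_mul]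
      linarith
    · right
      have h1 := Real.sin_pos_of_pos_of_lt_pi hx0 (hxφ.trans_lt hpi)
      have h2 := Real.sinh_pos_iff.2 hy
      have := mul_pos h1 h2
      linarith

lemma norm_cos_sub_cos_le (φ x : ℝ) {y : ℝ} (hy : 0 ≤ y) :
    ‖Complex.cos (x + y * Complex.I) - Real.cos φ‖ ≤ 2 * Real.exp y := by
  have h1 : ‖Complex.cos (x + y * Complex.I)‖ ≤ Real.exp y := by
    refine (Complex.norm_le_abs_re_add_abs_im _).trans ?_
    have hre := cos_sub_cos_re (Real.pi / 2) x y
    have him := cos_sub_cos_im (Real.pi / 2) x y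
    rw [Real.cos_pi_div_two, Complex.ofReal_zero, sub_zero] at hre him
    rw [hre, him, sub_zero, abs_neg, abs_mul, abs_mul, abs_of_pos (Real.cosh_pos y),
      abs_of_nonneg (Real.sinh_nonneg_iff.2 hy), ← Real.cosh_add_sinh]
    have := Real.abs_cos_le_one x
    have := Real.abs_sin_le_one x
    have := Real.cosh_pos y
    have := Real.sinh_nonneg_iff.2 hy
    nlinarith
  have h2 : ‖(Real.cos φ : ℂ)‖ ≤ 1 := by
    rw [Complex.norm_real]; exact Real.abs_cos_le_one φ
  have := norm_sub_le (Complex.cos (x + y * Complex.I)) (Real.cos φ)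
  have := Real.one_le_exp hy
  linarith

lemma norm_contourIntegrand (N p φ x y : ℝ) :
    ‖contourIntegrand N p φ (x + y * Complex.I)‖ =
      Real.exp (-(N * y)) * ‖Complex.cos (x + y * Complex.I) - Real.cos φ‖ ^ p := by
  rw [contourIntegrand, norm_mul, Complex.norm_cpow_real, Complex.norm_exp]
  simp [mul_assoc]

lemma re_contourIntegrand_ofReal (N p : ℝ) {φ x : ℝ} (hpi : φ < Real.pi) (hx0 : 0 ≤ x)
    (hxφ : x ≤ φ) :
    (contourIntegrand N p φ x).re = Real.cos (N * x) * (Real.cos x - Real.cos φ) ^ p := by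
  have h : 0 ≤ Real.cos x - Real.cos φ :=
    sub_nonneg.2 (Real.cos_le_cos_of_nonneg_of_le_pi hx0 hpi.le hxφ)
  rw [contourIntegrand, ← Complex.ofReal_cos, ← Complex.ofReal_sub, ← Complex.ofReal_cpow h,
    Complex.re_mul_ofReal, Complex.exp_re]
  simp

lemma im_contourIntegrand_mul_I (N p φ y : ℝ) :
    (contourIntegrand N p φ (y * Complex.I)).im = 0 := by
  have h : 0 ≤ Real.cosh y - Real.cos φ := by
    have := Real.one_le_cosh y
    have := Real.cos_le_one φ
    linarith
  have e : Complex.I * N * (y * Complex.I) = ((-(N * y) : ℝ) : ℂ) := by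
    push_cast
    linear_combination (N * y : ℂ) * Complex.I_mul_I
  rw [contourIntegrand, Complex.cos_mul_I, ← Complex.ofReal_cosh, ← Complex.ofReal_sub,
    ← Complex.ofReal_cpow h, e, ← Complex.ofReal_exp, ← Complex.ofReal_mul, Complex.ofReal_im]

lemma differentiableAt_contourIntegrand (N p : ℝ) {φ x y : ℝ} (hpi : φ < Real.pi) (hx0 : 0 ≤ x)
    (hxφ : x ≤ φ) (hy : 0 ≤ y) (h : x < φ ∨ 0 < y) :
    DifferentiableAt ℂ (contourIntegrand N p φ) (x + y * Complex.I) := by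
  have hs := cos_sub_cos_mem_slitPlane hpi hx0 hxφ hy h
  unfold contourIntegrand
  refine DifferentiableAt.mul (by fun_prop) (DifferentiableAt.cpow_const ?_ hs)
  fun_prop

/-- Cauchy's theorem on the rectangle `[0, x₀] × [0, T]`, real parts taken; the left edge
contributes nothing since the integrand is real on the imaginary axis. -/
lemma integral_rectangle_contourIntegrand (N p : ℝ) {φ x₀ T : ℝ} (hpi : φ < Real.pi)
    (hx0 : 0 < x₀) (hxφ : x₀ < φ) (hT : 0 < T) :
    ∫ t in (0 : ℝ)..x₀, Real.cos (N * t) * (Real.cos t - Real.cos φ) ^ p =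
      (∫ x in (0 : ℝ)..x₀, contourIntegrand N p φ (x + T * Complex.I)).re +
        (∫ y in (0 : ℝ)..T, contourIntegrand N p φ (x₀ + y * Complex.I)).im := by
  set f := contourIntegrand N p φ with hf
  have hdiff : ∀ x ∈ Icc 0 x₀, ∀ y ∈ Icc 0 T, DifferentiableAt ℂ f (x + y * Complex.I) :=
    fun x hx y hy => differentiableAt_contourIntegrand N p hpi hx.1 (hx.2.trans hxφ.le) hy.1
      (Or.inl (hx.2.trans_lt hxφ))
  have h := Complex.integral_boundary_rect_eq_zero_of_differentiableOn f 0 (x₀ + T * Complex.I) (by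
    intro z hz
    rw [Complex.mem_reProdIm] at hz
    simp [uIcc_of_le hx0.le, uIcc_of_le hT.le] at hz
    have := hdiff z.re hz.1 z.im hz.2
    rw [Complex.re_add_im] at this
    exact this.differentiableWithinAt)
  simp only [Complex.zero_re, Complex.zero_im, Complex.add_re, Complex.ofReal_re, Complex.mul_re,
    Complex.I_re, mul_zero, Complex.ofReal_im, Complex.I_im, mul_one, sub_self, add_zero,
    Complex.add_im, Complex.mul_im, zero_add, Complex.ofReal_zero, zero_mul, smul_eq_mul] at h
  have hre := congrArg Complex.re h
  simp only [Complex.add_re, Complex.sub_re, Complex.mul_re, Complex.I_re, Complex.I_im,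
    Complex.zero_re, zero_mul, one_mul, zero_sub] at hre
  have hc : IntervalIntegrable (fun x : ℝ => f x) volume 0 x₀ := by
    refine ContinuousOn.intervalIntegrable fun x hx => ?_
    rw [uIcc_of_le hx0.le] at hx
    have := (hdiff x hx 0 ⟨le_rfl, hT.le⟩).continuousAt
    rw [Complex.ofReal_zero, zero_mul, add_zero] at this
    exact (this.comp Complex.continuous_ofReal.continuousAt).continuousWithinAt
  have hcI : IntervalIntegrable (fun y : ℝ => f (y * Complex.I)) volume 0 T := by
    refine ContinuousOn.intervalIntegrable fun y hy => ?_
    rw [uIcc_of_le hT.le] at hy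
    have := (hdiff 0 ⟨le_rfl, hx0.le⟩ y hy).continuousAt
    rw [Complex.ofReal_zero, zero_add] at this
    exact (this.comp (f := fun y : ℝ => (y : ℂ) * Complex.I)
      (by fun_prop)).continuousWithinAt
  have e1 : (∫ x in (0 : ℝ)..x₀, f x).re =
      ∫ t in (0 : ℝ)..x₀, Real.cos (N * t) * (Real.cos t - Real.cos φ) ^ p := by
    have := Complex.reCLM.intervalIntegral_comp_comm hc
    simp only [Complex.reCLM_apply] at this
    rw [← this]
    refine intervalIntegral.integral_congr fun t ht => ?_
    rw [uIcc_of_le hx0.le] at ht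
    exact re_contourIntegrand_ofReal N p hpi ht.1 (ht.2.trans hxφ.le)
  have e2 : (∫ y in (0 : ℝ)..T, f (y * Complex.I)).im = 0 := by
    have := Complex.imCLM.intervalIntegral_comp_comm hcI
    simp only [Complex.imCLM_apply] at this
    rw [← this]
    simp only [hf, im_contourIntegrand_mul_I, intervalIntegral.integral_zero]
  linarith

/-- A majorant, uniform for abscissae in `[φ/2, φ]`, of the integrand on the vertical lines. -/
lemma norm_contourIntegrand_le {N p φ m x y : ℝ} (hm : 0 < m) (hmx : m ≤ Real.sin x)
    (hy : 0 < y) :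
    ‖contourIntegrand N p φ (x + y * Complex.I)‖ ≤
      m ^ p * (y ^ p * Real.exp (-(N * y))) + 2 ^ p * Real.exp (-(N - p) * y) := by
  have hlow : m * y ≤ ‖Complex.cos (x + y * Complex.I) - Real.cos φ‖ := by
    refine le_trans ?_ (Complex.abs_im_le_norm _)
    have h1 := Real.self_le_sinh_iff.2 hy.le
    have h2 := mul_le_mul hmx h1 hy.le (hm.le.trans hmx)
    rw [cos_sub_cos_im, abs_neg]
    exact h2.trans (le_abs_self _)
  have h := rpow_le_add_of_mem_Icc p (mul_pos hm hy) hlow (norm_cos_sub_cos_le φ x hy.le)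
  have e : Real.exp (-(N - p) * y) = Real.exp (-(N * y)) * Real.exp y ^ p := by
    rw [← Real.exp_mul, ← Real.exp_add]; congr 1; ring
  rw [norm_contourIntegrand, e]
  rw [Real.mul_rpow hm.le hy.le, Real.mul_rpow two_pos.le (Real.exp_pos y).le] at h
  calc _ ≤ Real.exp (-(N * y)) * (m ^ p * y ^ p + 2 ^ p * Real.exp y ^ p) := by gcongr
    _ = _ := by ring

lemma integrableOn_contour_majorant {N p : ℝ} (m : ℝ) (hN : 0 < N) (hp : -1 < p) (hNp : p < N) :
    IntegrableOn (fun y : ℝ => m ^ p * (y ^ p * Real.exp (-(N * y))) +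
      2 ^ p * Real.exp (-(N - p) * y)) (Ioi 0) :=
  ((integrableOn_rpow_mul_exp_neg_mul hp hN).const_mul _).add
    ((exp_neg_integrableOn_Ioi 0 (sub_pos.2 hNp)).const_mul _)

lemma continuousOn_contourIntegrand_vertical (N p : ℝ) {φ x : ℝ} (hpi : φ < Real.pi) (hx0 : 0 ≤ x)
    (hxφ : x ≤ φ) :
    ContinuousOn (fun y : ℝ => contourIntegrand N p φ (x + y * Complex.I)) (Ioi 0) := fun y hy =>
  ((differentiableAt_contourIntegrand N p hpi hx0 hxφ (le_of_lt hy)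
    (Or.inr hy)).continuousAt.comp (f := fun y : ℝ => (x : ℂ) + y * Complex.I)
      (by fun_prop)).continuousWithinAt

lemma tendsto_integral_top_edge {N p : ℝ} (φ x₀ : ℝ) (hN : 0 < N) (hNp : p < N) :
    Tendsto (fun T : ℝ => ∫ x in (0 : ℝ)..x₀, contourIntegrand N p φ (x + T * Complex.I))
      atTop (𝓝 0) := by
  have hlim : Tendsto (fun T : ℝ => (Real.exp (-(N * T)) + 2 ^ p * Real.exp (-((N - p) * T))) *
      |x₀ - 0|) atTop (𝓝 0) := by
    have h1 : ∀ r : ℝ, 0 < r → Tendsto (fun T : ℝ => Real.exp (-(r * T))) atTop (𝓝 0) := fun r hr =>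
      Real.tendsto_exp_neg_atTop_nhds_zero.comp (tendsto_id.const_mul_atTop hr)
    simpa using ((h1 N hN).add ((h1 (N - p) (sub_pos.2 hNp)).const_mul _)).mul_const |x₀ - 0|
  refine squeeze_zero_norm' ?_ hlim
  filter_upwards [eventually_ge_atTop (2 : ℝ)] with T hT
  refine intervalIntegral.norm_integral_le_of_norm_le_const fun x _ => ?_
  have hlow : (1 : ℝ) ≤ ‖Complex.cos (x + T * Complex.I) - Real.cos φ‖ := by
    have h1 : Real.sinh T ^ 2 ≤ ‖Complex.cos (x + T * Complex.I)‖ ^ 2 := by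
      have hre := cos_sub_cos_re (Real.pi / 2) x T
      have him := cos_sub_cos_im (Real.pi / 2) x T
      rw [Real.cos_pi_div_two, Complex.ofReal_zero, sub_zero] at hre him
      rw [Complex.sq_norm, Complex.normSq_apply, hre, him, sub_zero]
      nlinarith [Real.cosh_sq T, Real.sin_sq_add_cos_sq x, sq_nonneg (Real.cos x)]
    have h2 := Real.self_le_sinh_iff.2 (by linarith : (0 : ℝ) ≤ T)
    have h3 := abs_le_of_sq_le_sq h1 (norm_nonneg _)
    have h4 : ‖(Real.cos φ : ℂ)‖ ≤ 1 := by
      rw [Complex.norm_real]; exact Real.abs_cos_le_one φ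
    have h5 := norm_sub_norm_le (Complex.cos (x + T * Complex.I)) (Real.cos φ)
    have h6 := le_abs_self (Real.sinh T)
    linarith
  have h := rpow_le_add_of_mem_Icc p one_pos hlow (norm_cos_sub_cos_le φ x (by linarith))
  have e : Real.exp (-((N - p) * T)) = Real.exp (-(N * T)) * Real.exp T ^ p := by
    rw [← Real.exp_mul, ← Real.exp_add]; congr 1; ring
  rw [norm_contourIntegrand, e]
  rw [Real.one_rpow, Real.mul_rpow two_pos.le (Real.exp_pos T).le] at h
  calc _ ≤ Real.exp (-(N * T)) * (1 + 2 ^ p * Real.exp T ^ p) := by gcongr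
    _ = _ := by ring

lemma exists_pos_le_sin {φ : ℝ} (h0 : 0 < φ) (hpi : φ < Real.pi) :
    ∃ m, 0 < m ∧ ∀ x ∈ Icc (φ / 2) φ, m ≤ Real.sin x := by
  obtain ⟨x, hx, hmin⟩ := isCompact_Icc.exists_isMinOn (nonempty_Icc.2 (by linarith))
    (Real.continuous_sin.continuousOn (s := Icc (φ / 2) φ))
  exact ⟨Real.sin x, Real.sin_pos_of_pos_of_lt_pi (by linarith [hx.1]) (by linarith [hx.2]),
    fun y hy => hmin hy⟩

lemma integral_eq_im_vertical_of_lt {N p φ x₀ : ℝ} (h0 : 0 < φ) (hpi : φ < Real.pi)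
    (hx : φ / 2 ≤ x₀) (hxφ : x₀ < φ) (hN : 0 < N) (hp : -1 < p) (hNp : p < N) :
    ∫ t in (0 : ℝ)..x₀, Real.cos (N * t) * (Real.cos t - Real.cos φ) ^ p =
      (∫ y in Ioi (0 : ℝ), contourIntegrand N p φ (x₀ + y * Complex.I)).im := by
  have hx0 : 0 < x₀ := by linarith
  obtain ⟨m, hm, hms⟩ := exists_pos_le_sin h0 hpi
  have hint : IntegrableOn (fun y : ℝ => contourIntegrand N p φ (x₀ + y * Complex.I))
      (Ioi 0) := by
    refine (integrableOn_contour_majorant m hN hp hNp).mono'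
      ((continuousOn_contourIntegrand_vertical N p hpi hx0.le hxφ.le).aestronglyMeasurable
        measurableSet_Ioi) ?_
    exact (ae_restrict_iff' measurableSet_Ioi).2 (ae_of_all _ fun y hy =>
      norm_contourIntegrand_le hm (hms x₀ ⟨hx, hxφ.le⟩) hy)
  have h1 := (Complex.continuous_re.tendsto _).comp
    (tendsto_integral_top_edge φ x₀ hN hNp)
  have h2 := (Complex.continuous_im.tendsto _).comp
    (intervalIntegral_tendsto_integral_Ioi 0 hint tendsto_id)
  have h3 := h1.add h2
  rw [Complex.zero_re, zero_add] at h3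
  refine tendsto_nhds_unique (tendsto_const_nhds.congr' ?_) h3
  filter_upwards [eventually_gt_atTop (0 : ℝ)] with T hT
  exact integral_rectangle_contourIntegrand N p hpi hx0 hxφ hT

/-- The Mehler–Dirichlet integral is carried by the vertical half-line above `φ`. -/
lemma integral_eq_im_vertical {N p φ : ℝ} (h0 : 0 < φ) (hpi : φ < Real.pi)
    (hN : 0 < N) (hp : -1 < p) (hNp : p < N) :
    ∫ t in Ioo 0 φ, Real.cos (N * t) * (Real.cos t - Real.cos φ) ^ p =
      (∫ y in Ioi (0 : ℝ), contourIntegrand N p φ (φ + y * Complex.I)).im := by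
  obtain ⟨m, hm, hms⟩ := exists_pos_le_sin h0 hpi
  have hmem : ∀ᶠ x in 𝓝[<] φ, x ∈ Ico (φ / 2) φ := Ico_mem_nhdsLT (by linarith)
  have hR : Tendsto (fun x => ∫ t in (0 : ℝ)..x, Real.cos (N * t) *
      (Real.cos t - Real.cos φ) ^ p) (𝓝[<] φ)
      (𝓝 (∫ t in (0 : ℝ)..φ, Real.cos (N * t) * (Real.cos t - Real.cos φ) ^ p)) := by
    have hi := integrableOn_mehlerDirichlet (lam := p + 1) hN (by linarith) h0 hpi
    rw [add_sub_cancel_right, ← integrableOn_Icc_iff_integrableOn_Ioo,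
      ← uIcc_of_le h0.le] at hi
    have hc := intervalIntegral.continuousOn_primitive_interval hi
    rw [uIcc_of_le h0.le] at hc
    refine (hc φ ⟨h0.le, le_rfl⟩).mono_left ?_
    rw [nhdsWithin_le_iff]
    filter_upwards [hmem] with x hx
    exact ⟨by linarith [hx.1], hx.2.le⟩
  have hV : Tendsto (fun x : ℝ => ∫ y in Ioi (0 : ℝ), contourIntegrand N p φ (x + y * Complex.I))
      (𝓝[<] φ) (𝓝 (∫ y in Ioi (0 : ℝ), contourIntegrand N p φ (φ + y * Complex.I))) := by
    refine tendsto_integral_filter_of_dominated_convergence _ ?_ ?_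
      (integrableOn_contour_majorant m hN hp hNp) ?_
    · filter_upwards [hmem] with x hx
      exact (continuousOn_contourIntegrand_vertical N p hpi (by linarith [hx.1])
        hx.2.le).aestronglyMeasurable measurableSet_Ioi
    · filter_upwards [hmem] with x hx
      exact (ae_restrict_iff' measurableSet_Ioi).2 (ae_of_all _ fun y hy =>
        norm_contourIntegrand_le hm (hms x ⟨hx.1, hx.2.le⟩) hy)
    · refine (ae_restrict_iff' measurableSet_Ioi).2 (ae_of_all _ fun y hy => ?_)
      have hc := (differentiableAt_contourIntegrand N p hpi h0.le le_rfl (le_of_lt hy)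
        (Or.inr hy)).continuousAt
      have := hc.comp (f := fun x : ℝ => (x : ℂ) + y * Complex.I) (by fun_prop)
      exact this.tendsto.mono_left nhdsWithin_le_nhds
  rw [← integral_Ioc_eq_integral_Ioo, ← intervalIntegral.integral_of_le h0.le]
  refine tendsto_nhds_unique hR (((Complex.continuous_im.tendsto _).comp hV).congr' ?_)
  filter_upwards [hmem] with x hx
  exact (integral_eq_im_vertical_of_lt h0 hpi hx.1 hx.2 hN hp hNp).symm

/-! ### The Laplace representation of the remainder -/

/-- The integrand of the Laplace representation, without its exponential factor:
`sinh^p s (1 + i cot φ tanh (s/2))^p`, with `tanh (s/2)` written as `(cosh s - 1) / sinh s`. -/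
noncomputable def laplaceKernel (p φ s : ℝ) : ℂ :=
  (Real.sinh s ^ p : ℝ) *
    (1 + (Real.cos φ / Real.sin φ * ((Real.cosh s - 1) / Real.sinh s) : ℝ) * Complex.I) ^ (p : ℂ)

lemma one_add_ofReal_mul_I_mem_slitPlane (w : ℝ) : 1 + (w : ℂ) * Complex.I ∈ Complex.slitPlane :=
  Or.inl (by simp)

/-- On the vertical line through `φ` the base is `sin φ sinh y · (-i) · (1 + i cot φ tanh (y/2))`,
and the principal power is multiplicative on these factors. -/
lemma contourIntegrand_vertical (N p : ℝ) {φ y : ℝ} (h0 : 0 < φ) (hpi : φ < Real.pi)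
    (hy : 0 < y) :
    contourIntegrand N p φ (φ + y * Complex.I) =
      Complex.exp ((N * φ - p * (Real.pi / 2) : ℝ) * Complex.I) * (Real.sin φ ^ p : ℝ) *
        (Real.exp (-(N * y)) * laplaceKernel p φ y) := by
  have hs : 0 < Real.sin φ := Real.sin_pos_of_pos_of_lt_pi h0 hpi
  have hsh : 0 < Real.sinh y := Real.sinh_pos_iff.2 hy
  set w : ℝ := Real.cos φ / Real.sin φ * ((Real.cosh y - 1) / Real.sinh y) with hw
  set v : ℂ := 1 + (w : ℂ) * Complex.I with hv
  have hv0 : v ≠ 0 := Complex.slitPlane_ne_zero (one_add_ofReal_mul_I_mem_slitPlane w)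
  have hbase : Complex.cos (φ + y * Complex.I) - Real.cos φ =
      ((Real.sin φ * Real.sinh y : ℝ) : ℂ) * (-Complex.I * v) := by
    apply Complex.ext
    · rw [cos_sub_cos_re, Complex.re_ofReal_mul]
      simp only [hv, hw, Complex.mul_re, Complex.neg_re, Complex.neg_im, Complex.I_re,
        Complex.I_im, Complex.add_re, Complex.add_im, Complex.one_re, Complex.one_im,
        Complex.ofReal_re, Complex.ofReal_im, Complex.mul_im]
      field_simp
      ring
    · rw [cos_sub_cos_im, Complex.im_ofReal_mul]
      simp [hv]
  have hlog : Complex.log (((Real.sin φ * Real.sinh y : ℝ) : ℂ) * (-Complex.I * v)) =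
      (Real.log (Real.sin φ * Real.sinh y) : ℝ) +
        (-(Real.pi / 2 : ℝ) * Complex.I + Complex.log v) := by
    have hI : -Complex.I ≠ 0 := neg_ne_zero.2 Complex.I_ne_zero
    rw [Complex.log_ofReal_mul (by positivity) (mul_ne_zero hI hv0),
      Complex.log_mul hI hv0, Complex.log_neg_I]
    · push_cast; ring
    · have : |Complex.arg v| < Real.pi / 2 :=
        Complex.abs_arg_lt_pi_div_two_iff.2 (Or.inl (by simp [hv]))
      rw [Complex.arg_neg_I]
      constructor <;> linarith [abs_lt.1 this, Real.pi_pos]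
  have hb0 : ((Real.sin φ * Real.sinh y : ℝ) : ℂ) * (-Complex.I * v) ≠ 0 :=
    mul_ne_zero (Complex.ofReal_ne_zero.2 (by positivity))
      (mul_ne_zero (neg_ne_zero.2 Complex.I_ne_zero) hv0)
  rw [contourIntegrand, laplaceKernel, hbase, Complex.cpow_def_of_ne_zero hb0, hlog,
    Complex.cpow_def_of_ne_zero hv0, Real.rpow_def_of_pos hs, Real.rpow_def_of_pos hsh,
    Real.log_mul hs.ne' hsh.ne']
  push_cast
  simp only [← Complex.exp_add]
  congr 1
  linear_combination (N * y : ℂ) * Complex.I_mul_I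

lemma continuousOn_laplaceKernel (p φ : ℝ) : ContinuousOn (laplaceKernel p φ) (Ioi 0) := by
  intro s hs
  have hsh : Real.sinh s ≠ 0 := (Real.sinh_pos_iff.2 hs).ne'
  refine ContinuousAt.continuousWithinAt ?_
  unfold laplaceKernel
  refine ContinuousAt.mul ?_ (ContinuousAt.cpow ?_ continuousAt_const
    (one_add_ofReal_mul_I_mem_slitPlane _))
  · exact Complex.continuous_ofReal.continuousAt.comp
      (Real.continuous_sinh.continuousAt.rpow_const (Or.inl hsh))
  · refine continuousAt_const.add (ContinuousAt.mul (Complex.continuous_ofReal.continuousAt.comp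
      (continuousAt_const.mul (ContinuousAt.div ?_ ?_ hsh))) continuousAt_const)
    · exact (Real.continuous_cosh.sub continuous_const).continuousAt
    · exact Real.continuous_sinh.continuousAt

/-- The remainder is the Laplace transform, at `nu + lam`, of the kernel minus its leading part
`s ^ (lam - 1)`, whose own transform `Γ(lam) (nu + lam)^(-lam)` produces the cosine term. -/
lemma abs_remainder_le {lam nu φ : ℝ} (hlam : 0 < lam) (hnu : 0 < nu) (h0 : 0 < φ)
    (hpi : φ < Real.pi) {D : ℝ → ℝ} (hD : IntegrableOn D (Ioi 0))
    (hKD : ∀ s, 0 < s → Real.exp (-((nu + lam) * s)) *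
      ‖laplaceKernel (lam - 1) φ s - (s ^ (lam - 1) : ℝ)‖ ≤ D s) :
    |Real.sin φ ^ lam * rightGegenbauer lam nu (Real.cos φ) - gegenbauerLeadingTerm lam nu φ| ≤
      2 ^ lam * Real.Gamma (lam + 1 / 2) / (Real.sqrt Real.pi * Real.Gamma lam) *
        ∫ s in Ioi 0, D s := by
  have hs : 0 < Real.sin φ := Real.sin_pos_of_pos_of_lt_pi h0 hpi
  set N := nu + lam with hN
  have hN0 : 0 < N := by positivity
  set p := lam - 1 with hp
  set C := 2 ^ lam * Real.Gamma (lam + 1 / 2) / (Real.sqrt Real.pi * Real.Gamma lam) with hC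
  have hG := Real.Gamma_pos_of_pos hlam
  have hG' := Real.Gamma_pos_of_pos (show 0 < lam + 1 / 2 by positivity)
  have hsqrt := Real.sqrt_pos.2 Real.pi_pos
  have hC0 : 0 < C := by positivity
  set θ := N * φ - p * (Real.pi / 2) with hθ
  set K : ℝ → ℂ := fun s => Real.exp (-(N * s)) * laplaceKernel p φ s with hK
  set L : ℝ → ℂ := fun s => ((s ^ p * Real.exp (-(N * s)) : ℝ) : ℂ) with hL
  have hLint : IntegrableOn L (Ioi 0) :=
    (integrableOn_rpow_mul_exp_neg_mul (by rw [hp]; linarith) hN0).ofReal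
  have hKL : ∀ s, 0 < s → ‖K s - L s‖ ≤ D s := fun s hs => by
    refine le_trans (le_of_eq ?_) (hKD s hs)
    have : K s - L s = (Real.exp (-(N * s)) : ℝ) *
        (laplaceKernel p φ s - (s ^ p : ℝ)) := by
      simp only [hK, hL]; push_cast; ring
    rw [this, norm_mul, Complex.norm_real, Real.norm_eq_abs, Real.abs_exp]
  have hKcont : ContinuousOn K (Ioi 0) :=
    ContinuousOn.mul (by fun_prop) (continuousOn_laplaceKernel p φ)
  have hKL' : IntegrableOn (fun s => K s - L s) (Ioi 0) :=
    hD.mono' ((hKcont.aestronglyMeasurable measurableSet_Ioi).sub hLint.1)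
      ((ae_restrict_iff' measurableSet_Ioi).2 (ae_of_all _ hKL))
  have hKint : IntegrableOn K (Ioi 0) := by
    have := hKL'.add hLint
    refine this.congr_fun (fun s _ => by simp) measurableSet_Ioi
  have hLval : ∫ s in Ioi 0, L s = ((1 / N) ^ lam * Real.Gamma lam : ℝ) := by
    simp only [hL]
    rw [integral_complex_ofReal, Real.integral_rpow_mul_exp_neg_mul_Ioi hlam hN0]
  have hrep : ∫ t in Ioo 0 φ, Real.cos (N * t) * (Real.cos t - Real.cos φ) ^ p =
      Real.sin φ ^ p * (Complex.exp (θ * Complex.I) * ∫ s in Ioi 0, K s).im := by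
    rw [integral_eq_im_vertical h0 hpi hN0 (by rw [hp]; linarith) (by rw [hp, hN]; linarith),
      setIntegral_congr_fun measurableSet_Ioi fun y hy => contourIntegrand_vertical N p h0 hpi hy,
      integral_const_mul, mul_right_comm, mul_comm _ ((Real.sin φ ^ p : ℝ) : ℂ),
      Complex.im_ofReal_mul]
  have hmain : Real.sin φ ^ lam * rightGegenbauer lam nu (Real.cos φ) =
      C * (Complex.exp (θ * Complex.I) * ∫ s in Ioi 0, K s).im := by
    have h1 := sin_rpow_mul_rightGegenbauer_eq_integral hlam hnu h0 hpi
    rw [← hN, ← hp, ← hC, hrep] at h1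
    have h2 : Real.sin φ ^ (2 * lam - 1) = Real.sin φ ^ lam * Real.sin φ ^ p := by
      rw [← Real.rpow_add hs]; congr 1; rw [hp]; ring
    have h3 := (Real.rpow_pos_of_pos hs p).ne'
    rw [h2] at h1
    refine mul_left_cancel₀ h3 ?_
    linear_combination h1
  have hlead : gegenbauerLeadingTerm lam nu φ =
      C * (Complex.exp (θ * Complex.I) * ∫ s in Ioi 0, L s).im := by
    rw [hLval, Complex.im_mul_ofReal, Complex.exp_ofReal_mul_I_im, gegenbauerLeadingTerm, hC,
      ← hN, ← Real.cos_sub_pi_div_two, show N * φ - lam * Real.pi / 2 = θ - Real.pi / 2 by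
        rw [hθ, hp]; ring, Real.div_rpow one_pos.le hN0.le, Real.one_rpow]
    field_simp
  rw [hmain, hlead, ← mul_sub, ← Complex.sub_im, ← mul_sub, abs_mul, abs_of_pos hC0,
    ← integral_sub hKint hLint]
  refine mul_le_mul_of_nonneg_left ((Complex.abs_im_le_norm _).trans ?_) hC0.le
  rw [norm_mul, Complex.norm_exp_ofReal_mul_I, one_mul]
  exact norm_integral_le_of_norm_le hD
    ((ae_restrict_iff' measurableSet_Ioi).2 (ae_of_all _ hKL))

/-! ### Pointwise estimates of the kernel -/

lemma sinh_le_mul_cosh {s : ℝ} (hs : 0 ≤ s) : Real.sinh s ≤ s * Real.cosh s := by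
  have hd : ∀ x, HasDerivAt (fun x => x * Real.cosh x - Real.sinh x) (x * Real.sinh x) x :=
    fun x => (((hasDerivAt_id x).mul (Real.hasDerivAt_cosh x)).sub
      (Real.hasDerivAt_sinh x)).congr_deriv (by simp)
  have hm : MonotoneOn (fun x => x * Real.cosh x - Real.sinh x) (Ici 0) :=
    monotoneOn_of_deriv_nonneg (convex_Ici 0)
      (fun x _ => (hd x).continuousAt.continuousWithinAt)
      (fun x _ => (hd x).differentiableAt.differentiableWithinAt) fun x hx => by
        rw [interior_Ici] at hx
        rw [(hd x).deriv]
        exact mul_nonneg (le_of_lt hx) (Real.sinh_nonneg_iff.2 (le_of_lt hx))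
  have := hm (mem_Ici.2 le_rfl) hs hs
  simp only [zero_mul, Real.sinh_zero, sub_zero] at this
  linarith

lemma sinh_le_mul_exp {s : ℝ} (hs : 0 ≤ s) : Real.sinh s ≤ s * Real.exp s :=
  (sinh_le_mul_cosh hs).trans (mul_le_mul_of_nonneg_left
    (by linarith [Real.cosh_add_sinh s, Real.sinh_nonneg_iff.2 hs]) hs)

lemma tanh_half_mem_Icc {s : ℝ} (hs : 0 < s) :
    (Real.cosh s - 1) / Real.sinh s ∈ Icc 0 (s / 2) := by
  have hsh := Real.sinh_pos_iff.2 hs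
  refine ⟨div_nonneg (by linarith [Real.one_le_cosh s]) hsh.le, ?_⟩
  rw [div_le_iff₀ hsh]
  have h1 := Real.cosh_two_mul (s / 2)
  have h2 := Real.sinh_two_mul (s / 2)
  have h3 := Real.cosh_sq (s / 2)
  rw [mul_div_cancel₀ _ two_ne_zero] at h1 h2
  have h4 := sinh_le_mul_cosh (show 0 ≤ s / 2 by linarith)
  have h5 := mul_le_mul_of_nonneg_left h4 (Real.sinh_nonneg_iff.2 (show 0 ≤ s / 2 by linarith))
  rw [h1, h2]
  nlinarith

lemma abs_rpow_sub_one_le {X E : ℝ} (p : ℝ) (hX : 1 ≤ X) (hE : 1 ≤ E) (hXE : X ^ p ≤ E) :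
    |X ^ p - 1| ≤ |p| * Real.log X * E := by
  have hX0 : 0 < X := by linarith
  have hl := Real.log_nonneg hX
  rw [Real.rpow_def_of_pos hX0, mul_comm] at hXE ⊢
  rw [← abs_of_nonneg hl, ← abs_mul]
  set u := p * Real.log X with hu
  rw [abs_of_nonneg hl, ← hu]
  rcases le_total 0 u with h | h
  · rw [abs_of_nonneg (by linarith [Real.one_le_exp h]), abs_of_nonneg h]
    have h1 := Real.add_one_le_exp (-u)
    have h2 : Real.exp (-u) * Real.exp u = 1 := by rw [← Real.exp_add]; simp
    have h3 := Real.exp_pos u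
    nlinarith
  · rw [abs_of_nonpos (by linarith [Real.exp_le_one_iff.2 h]), abs_of_nonpos h]
    have h1 := Real.add_one_le_exp u
    nlinarith

lemma norm_one_add_mul_I_cpow_sub_one_le {p w V : ℝ}
    (hV : ∀ x ∈ Icc (0 : ℝ) 1, ‖1 + ((x * w : ℝ) : ℂ) * Complex.I‖ ^ (p - 1) ≤ V) :
    ‖(1 + (w : ℂ) * Complex.I) ^ (p : ℂ) - 1‖ ≤ |p| * |w| * V := by
  have hd : ∀ x : ℝ, HasDerivAt
      (fun x : ℝ => (1 + ((x * w : ℝ) : ℂ) * Complex.I) ^ (p : ℂ))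
      (p * (1 + ((x * w : ℝ) : ℂ) * Complex.I) ^ ((p : ℂ) - 1) * (w * Complex.I)) x := fun x => by
    have h1 : HasDerivAt (fun z : ℂ => 1 + z * w * Complex.I) (w * Complex.I) x :=
      ((((hasDerivAt_id (x : ℂ)).mul_const (w : ℂ)).mul_const Complex.I).const_add 1).congr_deriv
        (by simp)
    have h2 : 1 + (x : ℂ) * w * Complex.I ∈ Complex.slitPlane := by
      rw [← Complex.ofReal_mul]
      exact one_add_ofReal_mul_I_mem_slitPlane _
    simpa only [Complex.ofReal_mul] using (h1.cpow_const (c := (p : ℂ)) h2).comp_ofReal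
  have := norm_image_sub_le_of_norm_deriv_le_segment_01' (C := |p| * |w| * V)
    (fun x _ => (hd x).hasDerivWithinAt) fun x hx => by
      rw [norm_mul, norm_mul, ← Complex.ofReal_one, ← Complex.ofReal_sub, Complex.norm_cpow_real,
        norm_mul, Complex.norm_I, Complex.norm_real, Complex.norm_real, Complex.ofReal_one,
        Real.norm_eq_abs, Real.norm_eq_abs]
      calc _ = |p| * |w| * ‖1 + ((x * w : ℝ) : ℂ) * Complex.I‖ ^ (p - 1) := by ring
        _ ≤ _ := by gcongr; exact hV x ⟨hx.1, hx.2.le⟩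
  simpa using this

/-- Both cases of the theorem rest on this estimate: `E` dominates `(sinh s / s)^p` and `V`
dominates the growth of `z ^ (p - 1)` along the segment from `1` to `1 + i cot φ tanh (s/2)`. -/
lemma norm_laplaceKernel_sub_le {p φ s E V : ℝ} (hs : 0 < s) (hE : 1 ≤ E)
    (hXE : (Real.sinh s / s) ^ p ≤ E)
    (hV : ∀ x ∈ Icc (0 : ℝ) 1, ‖1 + ((x * (Real.cos φ / Real.sin φ *
      ((Real.cosh s - 1) / Real.sinh s)) : ℝ) : ℂ) * Complex.I‖ ^ (p - 1) ≤ V) :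
    ‖laplaceKernel p φ s - (s ^ p : ℝ)‖ ≤
      |p| * s ^ p * E * (|Real.cos φ / Real.sin φ| * (s / 2) * V + s ^ 2 / 2) := by
  have hX : 1 ≤ Real.sinh s / s := (one_le_div hs).2 (Real.self_le_sinh_iff.2 hs.le)
  have hX0 : 0 < Real.sinh s / s := by linarith
  have hV0 : 0 ≤ V := (Real.rpow_nonneg (norm_nonneg _) _).trans (hV 0 (by simp))
  obtain ⟨hτ0, hτ⟩ := tanh_half_mem_Icc hs
  set κ := Real.cos φ / Real.sin φ with hκ
  set τ := (Real.cosh s - 1) / Real.sinh s with hτdef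
  set X := Real.sinh s / s with hXdef
  have hlog : Real.log X ≤ s ^ 2 / 2 := by
    rw [Real.log_le_iff_le_exp hX0]
    refine le_trans ?_ (Real.cosh_le_exp_half_sq s)
    rw [hXdef, div_le_iff₀ hs, mul_comm]
    exact sinh_le_mul_cosh hs.le
  have hsinh : Real.sinh s ^ p = s ^ p * X ^ p := by
    rw [← Real.mul_rpow hs.le hX0.le, hXdef, mul_div_cancel₀ _ hs.ne']
  have e : laplaceKernel p φ s - (s ^ p : ℝ) = (s ^ p : ℝ) *
      ((X ^ p : ℝ) * ((1 + ((κ * τ : ℝ) : ℂ) * Complex.I) ^ (p : ℂ) - 1) +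
        ((X ^ p - 1 : ℝ) : ℂ)) := by
    change ((Real.sinh s ^ p : ℝ) : ℂ) * (1 + ((κ * τ : ℝ) : ℂ) * Complex.I) ^ (p : ℂ) -
      (s ^ p : ℝ) = _
    rw [hsinh, Complex.ofReal_mul, Complex.ofReal_sub, Complex.ofReal_one]
    ring
  have h1 := norm_one_add_mul_I_cpow_sub_one_le hV
  have h2 := abs_rpow_sub_one_le p hX hE hXE
  have hXp := Real.rpow_nonneg hX0.le p
  have hsp := Real.rpow_nonneg hs.le p
  rw [e, norm_mul, Complex.norm_real, Real.norm_of_nonneg hsp]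
  calc s ^ p * ‖((X ^ p : ℝ) : ℂ) * ((1 + ((κ * τ : ℝ) : ℂ) * Complex.I) ^ (p : ℂ) - 1) +
        ((X ^ p - 1 : ℝ) : ℂ)‖
      ≤ s ^ p * (X ^ p * (|p| * |κ * τ| * V) + |p| * Real.log X * E) := by
        gcongr
        refine (norm_add_le _ _).trans ?_
        rw [norm_mul, Complex.norm_real, Complex.norm_real, Real.norm_of_nonneg hXp,
          Real.norm_eq_abs]
        gcongr
    _ ≤ s ^ p * (E * (|p| * (|κ| * (s / 2)) * V) + |p| * (s ^ 2 / 2) * E) := by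
        rw [abs_mul κ, abs_of_nonneg hτ0]
        gcongr
    _ = _ := by ring

lemma one_le_norm_one_add_mul_I (w : ℝ) : 1 ≤ ‖1 + (w : ℂ) * Complex.I‖ := by
  have := Complex.abs_re_le_norm (1 + (w : ℂ) * Complex.I)
  simpa using this

lemma abs_cot_le {φ : ℝ} (hs : 0 < Real.sin φ) :
    |Real.cos φ / Real.sin φ| ≤ 1 / Real.sin φ := by
  rw [abs_div, abs_of_pos hs]
  gcongr
  exact Real.abs_cos_le_one φ

lemma sinh_div_self_rpow_le {p s : ℝ} (hs : 0 < s) (hp : 0 ≤ p) :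
    (Real.sinh s / s) ^ p ≤ Real.exp (p * s) := by
  rw [mul_comm, Real.exp_mul]
  refine Real.rpow_le_rpow (div_nonneg (Real.sinh_nonneg_iff.2 hs.le) hs.le) ?_ hp
  rw [div_le_iff₀ hs, mul_comm]
  exact sinh_le_mul_exp hs.le

/-- `(1/m)^a ≤ (1/ν)^a exp (a (ν - m) / m)`, that is `log (ν/m) ≤ ν/m - 1`. -/
lemma one_div_rpow_le_mul_exp {m ν a : ℝ} (hm : 0 < m) (hν : 0 < ν) (ha : 0 ≤ a) :
    (1 / m) ^ a ≤ (1 / ν) ^ a * Real.exp (a * (ν - m) / m) := by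
  have h : 1 / m = 1 / ν * (ν / m) := by field_simp
  rw [h, Real.mul_rpow (by positivity) (by positivity)]
  refine mul_le_mul_of_nonneg_left ?_ (by positivity)
  rw [Real.rpow_def_of_pos (by positivity), Real.exp_le_exp]
  have h1 := Real.log_le_sub_one_of_pos (show 0 < ν / m by positivity)
  calc Real.log (ν / m) * a ≤ (ν / m - 1) * a := by gcongr
    _ = _ := by field_simp

/-! ### The two error bounds -/

lemma integral_rpow_mul_exp_neg_mul {s r : ℝ} (hs : -1 < s) (hr : 0 < r) :
    ∫ t in Ioi (0 : ℝ), t ^ s * Real.exp (-(r * t)) = (1 / r) ^ (s + 1) * Real.Gamma (s + 1) := by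
  have h := Real.integral_rpow_mul_exp_neg_mul_Ioi (a := s + 1) (r := r) (by linarith) hr
  rwa [add_sub_cancel_right] at h

lemma abs_remainder_le_of_lam_le_two {lam nu φ : ℝ} (hlam : 0 < lam) (hnu : 0 < nu)
    (hlam2 : lam ≤ 2) (hm : 1 < nu + lam) (h0 : 0 < φ) (hpi : φ < Real.pi) :
    |Real.sin φ ^ lam * rightGegenbauer lam nu (Real.cos φ) - gegenbauerLeadingTerm lam nu φ| ≤
      gegenbauerBoundSmall lam nu / (nu ^ (lam + 1) * Real.sin φ) := by
  have hs : 0 < Real.sin φ := Real.sin_pos_of_pos_of_lt_pi h0 hpi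
  set m := nu + lam - 1 with hmdef
  have hm0 : 0 < m := by linarith
  set S := 1 / Real.sin φ with hS
  have hS1 : 1 ≤ S := (one_le_div hs).2 (Real.sin_le_one φ)
  have hi : ∀ a : ℝ, -1 < a → IntegrableOn (fun s : ℝ => s ^ a * Real.exp (-(m * s))) (Ioi 0) :=
    fun a ha => integrableOn_rpow_mul_exp_neg_mul ha hm0
  have hi1 := hi lam (by linarith)
  have hi2 := hi (lam + 1) (by linarith)
  have key := abs_remainder_le hlam hnu h0 hpi
    (D := fun s => |lam - 1| * S / 2 *
      (s ^ lam * Real.exp (-(m * s)) + s ^ (lam + 1) * Real.exp (-(m * s))))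
    ((hi1.add hi2).const_mul _) (fun s hs0 => by
      have hsp := Real.rpow_pos_of_pos hs0 (lam - 1)
      -- `(sinh s / s)^(lam - 1) ≤ e^s`, because `lam - 1 ≤ 1`
      have hE : (Real.sinh s / s) ^ (lam - 1) ≤ Real.exp s := by
        rcases le_total 0 (lam - 1) with hp | hp
        · refine (sinh_div_self_rpow_le hs0 hp).trans (Real.exp_le_exp.2 ?_)
          nlinarith
        · exact (Real.rpow_le_one_of_one_le_of_nonpos
            ((one_le_div hs0).2 (Real.self_le_sinh_iff.2 hs0.le)) hp).trans
              (Real.one_le_exp hs0.le)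
      have hk := norm_laplaceKernel_sub_le (φ := φ) (V := 1) hs0 (Real.one_le_exp hs0.le) hE
        (fun x _ => Real.rpow_le_one_of_one_le_of_nonpos (one_le_norm_one_add_mul_I _)
          (by linarith))
      have hcot := abs_cot_le hs
      have e1 : Real.exp (-((nu + lam) * s)) * Real.exp s = Real.exp (-(m * s)) := by
        rw [← Real.exp_add]; congr 1; rw [hmdef]; ring
      have e2 : s ^ lam = s ^ (lam - 1) * s := by
        rw [Real.rpow_sub_one hs0.ne']; field_simp
      have e3 : s ^ (lam + 1) = s ^ (lam - 1) * s ^ 2 := by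
        rw [Real.rpow_add_one hs0.ne', e2]; ring
      calc _ ≤ Real.exp (-((nu + lam) * s)) * (|lam - 1| * s ^ (lam - 1) * Real.exp s *
            (S * (s / 2) * 1 + S * (s ^ 2 / 2))) := by
            refine mul_le_mul_of_nonneg_left (hk.trans ?_) (Real.exp_pos _).le
            gcongr
            exact le_mul_of_one_le_left (by positivity) hS1
        _ = |lam - 1| * S / 2 * ((s ^ lam + s ^ (lam + 1)) *
            (Real.exp (-((nu + lam) * s)) * Real.exp s)) := by rw [e2, e3]; ring
        _ = _ := by rw [e1]; ring)
  refine key.trans ?_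
  rw [integral_const_mul, integral_add hi1 hi2, integral_rpow_mul_exp_neg_mul (by linarith) hm0,
    integral_rpow_mul_exp_neg_mul (by linarith) hm0, Real.Gamma_add_one (by linarith : lam + 1 ≠ 0),
    Real.Gamma_add_one hlam.ne', Real.rpow_add_one (by positivity) (lam + 1)]
  have hG := Real.Gamma_pos_of_pos hlam
  have hG' := Real.Gamma_pos_of_pos (show 0 < lam + 1 / 2 by positivity)
  have hsqrt := Real.sqrt_pos.2 Real.pi_pos
  have hexp := one_div_rpow_le_mul_exp hm0 hnu (show 0 ≤ lam + 1 by linarith)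
  have earg : (lam + 1) * (nu - m) / m = (1 - lam ^ 2) / (nu + lam - 1) := by
    rw [← hmdef]; congr 1; rw [hmdef]; ring
  rw [earg, Real.div_rpow one_pos.le hnu.le, Real.one_rpow] at hexp
  have e4 : (3 * nu + 5 * lam - 1) / (3 * (nu + lam - 1)) = 1 + 2 * (lam + 1) / (3 * m) := by
    rw [← hmdef]; field_simp; rw [hmdef]; ring
  rw [gegenbauerBoundSmall, e4]
  set C := 2 ^ lam * Real.Gamma (lam + 1 / 2) / Real.sqrt Real.pi with hC
  have hC0 : 0 < C := by positivity
  set X := (1 / nu ^ (lam + 1)) * Real.exp ((1 - lam ^ 2) / (nu + lam - 1)) with hX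
  calc _ = C * S * lam * |lam - 1| * ((1 + (lam + 1) / m) / 2) * (1 / m) ^ (lam + 1) := by
        rw [hC]; field_simp
    _ ≤ C * S * lam * |lam - 1| * (1 + 2 * (lam + 1) / (3 * m)) * X := by
        have h1 : (1 + (lam + 1) / m) / 2 ≤ 1 + 2 * (lam + 1) / (3 * m) := by
          have h2 : 0 ≤ (lam + 1) / m := by positivity
          have h3 : 2 * (lam + 1) / (3 * m) = 2 / 3 * ((lam + 1) / m) := by field_simp
          rw [h3]; linarith
        gcongr
    _ = _ := by rw [hC, hX, hS]; field_simp

/-- Jordan's inequality away from the ends of `[0, π]`. -/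
lemma two_div_pi_mul_le_sin {δ φ : ℝ} (hδ : 0 ≤ δ) (h1 : δ ≤ φ) (h2 : φ ≤ Real.pi - δ) :
    2 / Real.pi * δ ≤ Real.sin φ := by
  have hp : 0 ≤ 2 / Real.pi := by have := Real.pi_pos; positivity
  rcases le_total φ (Real.pi / 2) with h | h
  · exact (mul_le_mul_of_nonneg_left h1 hp).trans (Real.mul_le_sin (hδ.trans h1) h)
  · rw [← Real.sin_pi_sub]
    exact (mul_le_mul_of_nonneg_left (by linarith) hp).trans
      (Real.mul_le_sin (by linarith) (by linarith))

lemma norm_one_add_mul_I_rpow_le {q w W : ℝ} (hq : 0 ≤ q) (hwW : |w| ≤ W) :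
    ‖1 + (w : ℂ) * Complex.I‖ ^ q ≤ 2 ^ (q / 2) * (1 + W ^ q) := by
  have hW : 0 ≤ W := (abs_nonneg w).trans hwW
  have hM : 0 ≤ max 1 W := by positivity
  have h1 : ‖1 + (w : ℂ) * Complex.I‖ ≤ Real.sqrt 2 * max 1 W := by
    refine abs_le_of_sq_le_sq' ?_ (by positivity) |>.2
    rw [mul_pow, Real.sq_sqrt two_pos.le, Complex.sq_norm, Complex.normSq_apply]
    have h2 : w ^ 2 ≤ max 1 W ^ 2 := sq_le_sq' (by linarith [neg_abs_le w, le_max_right 1 W])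
      (by linarith [le_abs_self w, le_max_right 1 W])
    have h3 : 1 ≤ max 1 W ^ 2 := one_le_pow₀ (le_max_left 1 W)
    simp
    nlinarith
  refine (Real.rpow_le_rpow (norm_nonneg _) h1 hq).trans ?_
  rw [Real.mul_rpow (by positivity) hM, Real.sqrt_eq_rpow, ← Real.rpow_mul two_pos.le,
    show 1 / 2 * q = q / 2 by ring]
  refine mul_le_mul_of_nonneg_left ?_ (by positivity)
  have := Real.rpow_nonneg hW q
  rcases le_total 1 W with h | h
  · rw [max_eq_right h]; linarith
  · rw [max_eq_left h, Real.one_rpow]; linarith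

lemma abs_remainder_le_of_two_lt_lam {lam nu c φ : ℝ} (hnu : 0 < nu) (hlam2 : 2 < lam)
    (hm : lam - 3 < nu) (hc : 0 < c) (hφ : φ ∈ Icc (c / nu) (Real.pi - c / nu)) :
    |Real.sin φ ^ lam * rightGegenbauer lam nu (Real.cos φ) - gegenbauerLeadingTerm lam nu φ| ≤
      gegenbauerBoundLarge lam nu c / (nu ^ (lam + 1) * Real.sin φ) := by
  have hlam : 0 < lam := by linarith
  have hδ : 0 < c / nu := by positivity
  have h0 : 0 < φ := hδ.trans_le hφ.1
  have hpi : φ < Real.pi := by linarith [hφ.2]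
  have hs : 0 < Real.sin φ := Real.sin_pos_of_pos_of_lt_pi h0 hpi
  have hpos := Real.pi_pos
  set m := nu - lam + 3 with hmdef
  have hm0 : 0 < m := by linarith
  have hn0 : 0 < nu + 1 := by linarith
  set S := 1 / Real.sin φ with hS
  have hS1 : 1 ≤ S := (one_le_div hs).2 (Real.sin_le_one φ)
  set K := Real.pi / (4 * c) with hK
  have hK0 : 0 < K := by positivity
  -- `|cot φ| ≤ 1 / sin φ ≤ π ν / (2 c) = 2 K ν`
  have hSK : S ≤ 2 * K * nu := by
    have h1 := two_div_pi_mul_le_sin hδ.le hφ.1 hφ.2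
    have h2 : 2 / Real.pi * (c / nu) = 1 / (2 * K * nu) := by rw [hK]; field_simp; ring
    rw [h2] at h1
    rw [hS]
    exact (one_div_le hs (by positivity)).2 h1
  have hi := fun a (ha : -1 < a) r (hr : 0 < r) => integrableOn_rpow_mul_exp_neg_mul (s := a) ha
    (r := r) hr
  have hi1 := hi lam (by linarith) (nu + 1) hn0
  have hi2 := hi (lam + 1) (by linarith) (nu + 1) hn0
  have hi12 : IntegrableOn (fun s : ℝ => s ^ lam * Real.exp (-((nu + 1) * s)) +
      s ^ (lam + 1) * Real.exp (-((nu + 1) * s))) (Ioi 0) := hi1.add hi2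
  have hi3 := hi (2 * lam - 2) (by linarith) m hm0
  have key := abs_remainder_le hlam hnu h0 hpi
    (D := fun s => (lam - 1) * S * 2 ^ ((lam - 2) / 2) / 2 *
      ((s ^ lam * Real.exp (-((nu + 1) * s)) + s ^ (lam + 1) * Real.exp (-((nu + 1) * s))) +
        (K * nu) ^ (lam - 2) * (s ^ (2 * lam - 2) * Real.exp (-(m * s)))))
    ((hi12.add (hi3.const_mul _)).const_mul _) (fun s hs0 => by
      have hsp := Real.rpow_pos_of_pos hs0 (lam - 1)
      have hcot := abs_cot_le hs
      obtain ⟨hτ0, hτ⟩ := tanh_half_mem_Icc hs0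
      have hk := norm_laplaceKernel_sub_le (φ := φ) (p := lam - 1)
        (V := 2 ^ ((lam - 2) / 2) * (1 + (K * nu * s) ^ (lam - 2))) hs0
        (Real.one_le_exp (mul_nonneg (by linarith : 0 ≤ lam - 1) hs0.le))
        (sinh_div_self_rpow_le hs0 (by linarith)) (fun x hx => by
          rw [show lam - 1 - 1 = lam - 2 by ring]
          refine norm_one_add_mul_I_rpow_le (by linarith) ?_
          rw [abs_mul, abs_mul, abs_of_nonneg hx.1, abs_of_nonneg hτ0]
          calc _ ≤ 1 * ((2 * K * nu) * (s / 2)) := by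
                gcongr
                · exact hx.2
                · exact hcot.trans hSK
            _ = _ := by ring)
      rw [abs_of_nonneg (by linarith : 0 ≤ lam - 1)] at hk
      have hV1 : (1 : ℝ) ≤ 2 ^ ((lam - 2) / 2) := Real.one_le_rpow one_le_two (by linarith)
      have e1 : Real.exp (-((nu + lam) * s)) * Real.exp ((lam - 1) * s) =
          Real.exp (-((nu + 1) * s)) := by
        rw [← Real.exp_add]; congr 1; ring
      have e1' : Real.exp (-((nu + 1) * s)) ≤ Real.exp (-(m * s)) := by
        rw [Real.exp_le_exp]
        have : m * s ≤ (nu + 1) * s := by gcongr; linarith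
        linarith
      have e2 : s ^ lam = s ^ (lam - 1) * s := by
        rw [Real.rpow_sub_one hs0.ne']; field_simp
      have e3 : s ^ (lam + 1) = s ^ (lam - 1) * s ^ 2 := by
        rw [Real.rpow_add_one hs0.ne', e2]; ring
      have e4 : s ^ (2 * lam - 2) = s ^ (lam - 1) * s * s ^ (lam - 2) := by
        rw [← e2, ← Real.rpow_add hs0]; congr 1; ring
      have e5 : (K * nu * s) ^ (lam - 2) = (K * nu) ^ (lam - 2) * s ^ (lam - 2) :=
        Real.mul_rpow (by positivity) hs0.le
      have hl1 : 0 ≤ lam - 1 := by linarith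
      calc _ ≤ Real.exp (-((nu + lam) * s)) * ((lam - 1) * s ^ (lam - 1) *
            Real.exp ((lam - 1) * s) *
            (S * (s / 2) * (2 ^ ((lam - 2) / 2) * (1 + (K * nu * s) ^ (lam - 2))) +
              S * 2 ^ ((lam - 2) / 2) * (s ^ 2 / 2))) := by
            refine mul_le_mul_of_nonneg_left (hk.trans ?_) (Real.exp_pos _).le
            gcongr
            exact le_mul_of_one_le_left (by positivity) (one_le_mul_of_one_le_of_one_le hS1 hV1)
        _ = (lam - 1) * S * 2 ^ ((lam - 2) / 2) / 2 *
            ((s ^ lam + s ^ (lam + 1) + (K * nu) ^ (lam - 2) * s ^ (2 * lam - 2)) *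
            (Real.exp (-((nu + lam) * s)) * Real.exp ((lam - 1) * s))) := by
            rw [e2, e3, e4, e5]; ring
        _ = (lam - 1) * S * 2 ^ ((lam - 2) / 2) / 2 *
            ((s ^ lam * Real.exp (-((nu + 1) * s)) + s ^ (lam + 1) * Real.exp (-((nu + 1) * s))) +
            (K * nu) ^ (lam - 2) * (s ^ (2 * lam - 2) * Real.exp (-((nu + 1) * s)))) := by
            rw [e1]; ring
        _ ≤ _ := by gcongr)
  refine key.trans ?_
  rw [integral_const_mul, integral_add hi12 (hi3.const_mul _), integral_add hi1 hi2,
    integral_const_mul, integral_rpow_mul_exp_neg_mul (by linarith) hn0,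
    integral_rpow_mul_exp_neg_mul (by linarith) hn0,
    integral_rpow_mul_exp_neg_mul (by linarith) hm0,
    Real.Gamma_add_one (by linarith : lam + 1 ≠ 0), Real.rpow_add_one (by positivity) (lam + 1),
    show 2 * lam - 2 + 1 = 2 * lam - 1 by ring]
  have hGa := Real.Gamma_add_one hlam.ne'
  have hG := Real.Gamma_pos_of_pos hlam
  have hG2 := Real.Gamma_pos_of_pos (show 0 < 2 * lam - 1 by linarith)
  have hG' := Real.Gamma_pos_of_pos (show 0 < lam + 1 / 2 by positivity)
  have hsqrt := Real.sqrt_pos.2 Real.pi_pos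
  have hl1 : 0 < lam - 1 := by linarith
  set P := 1 / nu ^ (lam + 1) with hP
  have hP0 : 0 < P := by positivity
  have hA : (1 / (nu + 1)) ^ (lam + 1) ≤ P := by
    rw [Real.div_rpow one_pos.le hn0.le, Real.one_rpow]
    exact one_div_le_one_div_of_le (by positivity)
      (Real.rpow_le_rpow hnu.le (by linarith) (by linarith))
  set X := Real.exp ((2 * lam - 5) * (lam + 1) / (nu - lam + 3)) with hX
  have hB : nu ^ (lam - 2) * (1 / m) ^ (2 * lam - 1) ≤ P * X := by
    have h1 := one_div_rpow_le_mul_exp hm0 hnu (show 0 ≤ 2 * lam - 1 by linarith)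
    have h2 : Real.exp ((2 * lam - 1) * (nu - m) / m) ≤ X := by
      rw [hX, Real.exp_le_exp, ← hmdef]
      have : (2 * lam - 1) * (nu - m) ≤ (2 * lam - 5) * (lam + 1) := by rw [hmdef]; nlinarith
      gcongr
    have h3 : nu ^ (lam - 2) * (1 / nu) ^ (2 * lam - 1) = P := by
      rw [hP, Real.div_rpow one_pos.le hnu.le, Real.one_rpow,
        show 2 * lam - 1 = (lam - 2) + (lam + 1) by ring, Real.rpow_add hnu]
      field_simp
    calc _ ≤ nu ^ (lam - 2) * ((1 / nu) ^ (2 * lam - 1) * X) := by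
          gcongr
          exact h1.trans (by gcongr)
      _ = _ := by rw [← mul_assoc, h3]
  have e4 : (3 * nu + 2 * lam + 5) / (nu + 1) = 3 + 2 * ((lam + 1) / (nu + 1)) := by
    field_simp; ring
  have e5 : (3 * nu + lam + 7) / (nu - lam + 3) = 3 + (4 * lam - 2) / m := by
    rw [← hmdef]; field_simp; rw [hmdef]; ring
  have e6 : (2 : ℝ) ^ (3 * lam / 2) = 2 ^ lam * (2 ^ ((lam - 2) / 2) * 2) := by
    rw [← Real.rpow_add_one two_ne_zero, ← Real.rpow_add two_pos]; congr 1; ring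
  rw [gegenbauerBoundLarge, ← hX, e4, e5, e6, hGa, Real.mul_rpow hK0.le hnu.le]
  set R := K ^ (lam - 2) with hR
  have hR0 : 0 < R := by positivity
  set T := (2 : ℝ) ^ ((lam - 2) / 2) with hT
  have hT0 : 0 < T := by positivity
  set C := 2 ^ lam * Real.Gamma (lam + 1 / 2) / Real.sqrt Real.pi with hC
  have hC0 : 0 < C := by positivity
  set G := Real.Gamma (2 * lam - 1) / (lam * Real.Gamma lam) with hGdef
  have hG0 : 0 < G := by positivity
  have hu : 0 ≤ (lam + 1) / (nu + 1) := by positivity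
  have hv : 0 ≤ (4 * lam - 2) / m := div_nonneg (by linarith) hm0.le
  calc _ = C * S * lam * (lam - 1) * T * ((1 + (lam + 1) / (nu + 1)) / 2 *
          (1 / (nu + 1)) ^ (lam + 1) +
          1 / 2 * R * G * (nu ^ (lam - 2) * (1 / m) ^ (2 * lam - 1))) := by
        rw [hC, hGdef]; field_simp
    _ ≤ C * S * lam * (lam - 1) * T * ((2 / 3 * (3 + 2 * ((lam + 1) / (nu + 1)))) * P +
          (2 / 3 * (3 + (4 * lam - 2) / m)) * R * G * (P * X)) := by
        gcongr
        · linarith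
        · linarith
    _ = _ := by rw [hC, hP, hS]; field_simp

theorem mainTheorem2 (lam nu : ℝ) (hlam : 0 < lam) (hnu : 0 < nu) :
    (lam ≤ 2 → 1 < nu + lam → ∀ φ ∈ Set.Ioo 0 Real.pi,
      |(Real.sin φ) ^ lam * rightGegenbauer lam nu (Real.cos φ) - gegenbauerLeadingTerm lam nu φ|
        ≤ gegenbauerBoundSmall lam nu / (nu ^ (lam + 1) * Real.sin φ)) ∧
    (2 < lam → lam - 3 < nu → ∀ c : ℝ, 0 < c → ∀ φ ∈ Set.Icc (c / nu) (Real.pi - c / nu),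
      |(Real.sin φ) ^ lam * rightGegenbauer lam nu (Real.cos φ) - gegenbauerLeadingTerm lam nu φ|
        ≤ gegenbauerBoundLarge lam nu c / (nu ^ (lam + 1) * Real.sin φ)) :=
  ⟨fun h2 hm _ hφ => abs_remainder_le_of_lam_le_two hlam hnu h2 hm hφ.1 hφ.2,
    fun h2 hm _ hc _ hφ => abs_remainder_le_of_two_lt_lam hnu h2 hm hc hφ⟩
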